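/- Let $p$ be a prime, let $k$ be an $F$-finite field of characteristic $p$, let $R$ be a ring of characteristic $p$ that is essentially of finite type over $k$, and let $f\in R$. A (coherent) Cartier module is a finitely generated $R$-module $M$ with an additive map $\kappa\colon M\to M$ such that $\kappa(r^pm)=r\kappa(m)$, i.e. an $R$-linear map $\kappa\colon F_*M\to M$; it is nilpotent if $\kappa^e=0$ for some $e\ge 0$. A morphism of Cartier modules is an $R$-linear map commuting with $\kappa$, and it is a nil-isomorphism if its kernel and cokernel are nilpotent. For $t\in\mathbb{Q}_{\ge 0}$ let $\mathcal{C}=\mathcal{C}(f^t)$ be the Cartier algebra generated in degrees $e\ge 1$ by $\kappa^e f^{\lceil tp^e\rceil}$, let $\mathcal{C}_+$ be its part of positive degree, so that $\mathcal{C}_+N=\sum_{e\ge 1}\kappa^e(f^{\lceil tp^e\rceil}N)$ for every $R$-submodule $N\subseteq M$, and let $\underline{M}=(\mathcal{C}_+)^hM$ for $h\gg 0$. The test module $\tau(M,f^t)$ is the smallest $\mathcal{C}$-submodule $N$ of $M$ such that $N_\eta=\underline{M}_\eta$ for every generic point $\eta$ of $\operatorname{Supp}\underline{M}$. Let $F^{e!}M=\operatorname{Hom}_R(F^e_*R,M)$,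 an $R$-module through the first argument and a Cartier module via $\psi\mapsto\kappa\circ\psi\circ F$. Let $\mathcal{M}=\operatorname{colim}_eF^{e!}M$ be the colimit along the maps $F^{e!}M\to F^{(e+1)!}M$, $\psi\mapsto\kappa\circ\psi$, induced by $C\colon M\to F^!M$, $m\mapsto[r\mapsto\kappa(rm)]$, with the induced Cartier structure. Let $\tau(\mathcal{M},f^t)$ be the image of $\tau(M,f^t)$ under the natural map $M=F^{0!}M\to\mathcal{M}$. Let $\varphi\colon M\to N$ be a nil-isomorphism of Cartier modules, and let $\mathcal{N}=\operatorname{colim}_eF^{e!}N$. Then: 1. For all $t\in\mathbb{Q}_{\ge 0}$ the test modules $\tau(M,f^t)$ and $\tau(N,f^t)$ exist (in particular the chains $(\mathcal{C}_+)^hM$ and $(\mathcal{C}_+)^hN$ become stationary), and $\varphi(\tau(M,f^t))=\tau(N,f^t)$. 2. The submodules $\tau(\mathcal{M},f^t)$, $t\in\mathbb{Q}_{\ge 0}$, form a decreasing filtration of $\mathcal{M}$. It is well defined in the sense that for all $e\ge 0$ and $t\in\mathbb{Q}_{\ge 0}$ the test module $\tau(F^{e!}M,f^t)$ exists and its image under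 $F^{e!}M\to\mathcal{M}$ is $\tau(\mathcal{M},f^t)$. 3. The morphism of Cartier modules $\Phi\colon\mathcal{M}\to\mathcal{N}$ induced by the maps $F^{e!}\varphi$ is an isomorphism, and $\Phi(\tau(\mathcal{M},f^t))=\tau(\mathcal{N},f^t)$ for all $t\in\mathbb{Q}_{\ge 0}$. -/

import Mathlib

noncomputable section

namespace CartierModule

universe u v w x

/-- A Cartier structure on an `R`-module `M` over a ring `R` of characteristic `p`: an `R`-linear
map `κ : F_* M → M`, i.e. an additive map `κ : M → M` with `κ (r ^ p • m) = r • κ m`. -/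
structure CartierStructure (p : ℕ) (R : Type u) (M : Type v) [CommRing R] [AddCommGroup M]
    [Module R M] extends M →+ M where
  map_pow_smul' : ∀ (r : R) (m : M), toFun (r ^ p • m) = r • toFun m

namespace CartierStructure

variable {p : ℕ} {R : Type u} {M : Type v} [CommRing R] [AddCommGroup M] [Module R M]

instance : FunLike (CartierStructure p R M) M M where
  coe κ := κ.toFun
  coe_injective κ κ' h := by
    obtain ⟨⟨⟨_, _⟩, _⟩, _⟩ := κ
    obtain ⟨⟨⟨_, _⟩, _⟩, _⟩ := κ'
    cases h
    rfl

instance : AddMonoidHomClass (CartierStructure p R M) M M where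
  map_add κ := κ.toAddMonoidHom.map_add
  map_zero κ := κ.toAddMonoidHom.map_zero

theorem map_pow_smul (κ : CartierStructure p R M) (r : R) (m : M) :
    κ (r ^ p • m) = r • κ m :=
  κ.map_pow_smul' r m

/-- The iterate `κ^e`, as an additive map. -/
def iter (κ : CartierStructure p R M) (e : ℕ) : M →+ M where
  toFun := κ^[e]
  map_zero' := Function.iterate_fixed (map_zero κ) e
  map_add' a b := iterate_map_add κ e a b

theorem iter_succ_apply (κ : CartierStructure p R M) (e : ℕ) (m : M) :
    κ.iter (e + 1) m = κ (κ.iter e m) :=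
  Function.iterate_succ_apply' κ e m

theorem iter_succ_apply' (κ : CartierStructure p R M) (e : ℕ) (m : M) :
    κ.iter (e + 1) m = κ.iter e (κ m) :=
  Function.iterate_succ_apply κ e m

/-- `κ^e` is an `R`-linear map `F^e_* M → M`. -/
theorem iter_pow_smul (κ : CartierStructure p R M) (e : ℕ) (r : R) (m : M) :
    κ.iter e (r ^ p ^ e • m) = r • κ.iter e m := by
  induction e generalizing r with
  | zero => simp [iter]
  | succ e ih => rw [iter_succ_apply, iter_succ_apply, pow_succ', pow_mul, ih, map_pow_smul]

/-- `(M, κ)` is nilpotent if some power of `κ` vanishes on `M`. -/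
def IsNilpotent (κ : CartierStructure p R M) : Prop :=
  ∃ e : ℕ, ∀ m : M, κ.iter e m = 0

/-! ### Test modules

For `f : R` and `t : ℚ≥0` let `C` be the Cartier algebra generated in degrees `e ≥ 1` by
`κ^e f^⌈t p^e⌉`. Since `r κ = κ r^p` and `p^d ⌈t p^e⌉ + ⌈t p^d⌉ ≥ ⌈t p^(d+e)⌉`, its part of degree
`e ≥ 1` is `κ^e f^⌈t p^e⌉ R`. -/

/-- `C_+ N`, the submodule spanned by all `κ^e (f^⌈t p^e⌉ n)` with `e ≥ 1` and `n ∈ N`. -/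
def plus (κ : CartierStructure p R M) (f : R) (t : ℚ≥0) (N : Submodule R M) : Submodule R M :=
  Submodule.span R {m | ∃ e : ℕ, 1 ≤ e ∧ ∃ n ∈ N, m = κ.iter e (f ^ ⌈t * (p : ℚ≥0) ^ e⌉₊ • n)}

/-- `(C_+)^h M`. -/
def plusPow (κ : CartierStructure p R M) (f : R) (t : ℚ≥0) (h : ℕ) : Submodule R M :=
  (κ.plus f t)^[h] ⊤

/-- The stable value `(C_+)^h M`, `h ≫ 0`, of the decreasing chain of the `(C_+)^h M`
(it is their intersection whenever the chain is stationary). -/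
def underline (κ : CartierStructure p R M) (f : R) (t : ℚ≥0) : Submodule R M :=
  ⨅ h, κ.plusPow f t h

/-- `N` and `P` agree generically on `P`: they have the same localization at every generic point
(that is, minimal element) of `Supp P`. -/
def GenericallyAgree (N P : Submodule R M) : Prop :=
  ∀ η : PrimeSpectrum R, Minimal (· ∈ Module.support R P) η →
    N.localized η.asIdeal.primeCompl = P.localized η.asIdeal.primeCompl

/-- The `C`-submodules of `M` that generically agree with the stable value of `(C_+)^h M`. -/
def testSubmodules (κ : CartierStructure p R M) (f : R) (t : ℚ≥0) : Set (Submodule R M) :=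
  {N | κ.plus f t N ≤ N ∧ GenericallyAgree N (κ.underline f t)}

/-- The test module `τ(M, f^t)`: the smallest `C`-submodule of `M` that generically agrees with
the stable value of `(C_+)^h M`. -/
def testModule (κ : CartierStructure p R M) (f : R) (t : ℚ≥0) : Submodule R M :=
  sInf (κ.testSubmodules f t)

/-- The test module exists: the chain `(C_+)^h M` is stationary, and there is a smallest
`C`-submodule that generically agrees with its stable value. -/
def HasTestModule (κ : CartierStructure p R M) (f : R) (t : ℚ≥0) : Prop :=
  (∀ᶠ h in Filter.atTop, κ.plusPow f t h = κ.underline f t) ∧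
    IsLeast (κ.testSubmodules f t) (κ.testModule f t)

end CartierStructure

/-- A morphism of Cartier modules: an `R`-linear map that commutes with the structural maps. -/
structure CartierHom {p : ℕ} {R : Type u} {M : Type v} {N : Type w} [CommRing R]
    [AddCommGroup M] [Module R M] [AddCommGroup N] [Module R N]
    (κM : CartierStructure p R M) (κN : CartierStructure p R N) extends M →ₗ[R] N where
  map_cartier' : ∀ m : M, toFun (κM m) = κN (toFun m)

namespace CartierHom

variable {p : ℕ} {R : Type u} {M : Type v} {N : Type w} [CommRing R]
  [AddCommGroup M] [Module R M] [AddCommGroup N] [Module R N]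
  {κM : CartierStructure p R M} {κN : CartierStructure p R N}

theorem map_cartier (φ : CartierHom κM κN) (m : M) :
    φ.toLinearMap (κM m) = κN (φ.toLinearMap m) :=
  φ.map_cartier' m

theorem map_iter (φ : CartierHom κM κN) (e : ℕ) (m : M) :
    φ.toLinearMap (κM.iter e m) = κN.iter e (φ.toLinearMap m) := by
  induction e with
  | zero => rfl
  | succ e ih => rw [CartierStructure.iter_succ_apply, map_cartier, ih,
      CartierStructure.iter_succ_apply]

/-- The Cartier structure induced on the kernel. -/
def ker (φ : CartierHom κM κN) : CartierStructure p R (LinearMap.ker φ.toLinearMap) where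
  toFun m := ⟨κM m, by
    rw [LinearMap.mem_ker, map_cartier, LinearMap.mem_ker.mp m.2, map_zero]⟩
  map_zero' := by ext; simp
  map_add' a b := by ext; simp
  map_pow_smul' r m := by ext; simp [κM.map_pow_smul]

/-- The Cartier structure induced on the cokernel. -/
def coker (φ : CartierHom κM κN) :
    CartierStructure p R (N ⧸ LinearMap.range φ.toLinearMap) where
  toAddMonoidHom := QuotientAddGroup.map _ _ κN.toAddMonoidHom (by
    rintro _ ⟨m, rfl⟩
    exact ⟨κM m, φ.map_cartier m⟩)
  map_pow_smul' r n := by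
    obtain ⟨n, rfl⟩ := Submodule.Quotient.mk_surjective _ n
    exact congrArg Submodule.Quotient.mk (κN.map_pow_smul r n)

/-- A nil-isomorphism: the kernel and the cokernel are nilpotent Cartier modules. -/
def IsNilIso (φ : CartierHom κM κN) : Prop :=
  φ.ker.IsNilpotent ∧ φ.coker.IsNilpotent

end CartierHom

/-! ### The functors `F^{e!}` and the unit module -/

section Shriek

variable (p : ℕ) (e : ℕ) (R : Type u) (M : Type v) [CommRing R] [AddCommGroup M] [Module R M]

/-- The `R`-linear maps `F^e_* R → M`, as a subgroup of the additive maps `R → M`. -/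
def shriekSubgroup : AddSubgroup (R →+ M) where
  carrier := {ψ | ∀ r s : R, ψ (r ^ p ^ e * s) = r • ψ s}
  zero_mem' r s := by simp
  add_mem' ha hb r s := by simp [ha r s, hb r s]
  neg_mem' ha r s := by simp [ha r s]

/-- `F^{e!} M = Hom_R(F^e_* R, M)`. -/
def FShriek : Type (max u v) := shriekSubgroup p e R M

namespace FShriek

variable {p e R M}

instance : AddCommGroup (FShriek p e R M) := inferInstanceAs (AddCommGroup (shriekSubgroup p e R M))

instance : FunLike (FShriek p e R M) R M where
  coe ψ := ψ.1
  coe_injective _ _ h := Subtype.ext (DFunLike.coe_injective h)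

instance : AddMonoidHomClass (FShriek p e R M) R M where
  map_add ψ := ψ.1.map_add
  map_zero ψ := ψ.1.map_zero

theorem map_pow_mul (ψ : FShriek p e R M) (r s : R) : ψ (r ^ p ^ e * s) = r • ψ s := ψ.2 r s

@[ext] theorem ext {ψ ψ' : FShriek p e R M} (h : ∀ s, ψ s = ψ' s) : ψ = ψ' := DFunLike.ext _ _ h

@[simp] theorem add_apply (ψ ψ' : FShriek p e R M) (s : R) : (ψ + ψ') s = ψ s + ψ' s := rfl

@[simp] theorem zero_apply (s : R) : (0 : FShriek p e R M) s = 0 := rfl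

/-- `R` acts on `Hom_R(F^e_* R, M)` through the first argument. -/
instance : SMul R (FShriek p e R M) where
  smul r ψ := ⟨ψ.1.comp (AddMonoidHom.mulLeft r), fun a s => by
    have h := ψ.2 a (r * s)
    simpa [mul_left_comm] using h⟩

@[simp] theorem smul_apply (r : R) (ψ : FShriek p e R M) (s : R) : (r • ψ) s = ψ (r * s) := rfl

instance : Module R (FShriek p e R M) where
  one_smul ψ := by ext; simp
  mul_smul a b ψ := by ext s; simp [mul_left_comm, mul_assoc]
  smul_zero a := by ext; simp
  smul_add a ψ ψ' := by ext; simp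
  add_smul a b ψ := by ext; simp [add_mul]
  zero_smul ψ := by ext; simp

/-- The identification `M = F^{0!} M`, `m ↦ [r ↦ r m]`. -/
def zeroEmb : M →ₗ[R] FShriek p 0 R M where
  toFun m := ⟨(AddMonoidHom.flip (smulAddHom R M)) m, fun r s => by simp [mul_smul]⟩
  map_add' a b := by ext s; exact smul_add s a b
  map_smul' r m := by ext s; exact (smul_smul s r m).trans (by rw [mul_comm]; rfl)

/-- Functoriality: `F^{e!} g` is composition with `g`. -/
def map {N : Type w} [AddCommGroup N] [Module R N] (g : M →ₗ[R] N) :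
    FShriek p e R M →ₗ[R] FShriek p e R N where
  toFun ψ := ⟨g.toAddMonoidHom.comp ψ.1, fun r s => by
    have h := ψ.2 r s
    simp [h]⟩
  map_add' a b := by ext s; exact map_add g (a s) (b s)
  map_smul' r m := rfl

@[simp] theorem map_apply {N : Type w} [AddCommGroup N] [Module R N] (g : M →ₗ[R] N)
    (ψ : FShriek p e R M) (s : R) : map g ψ s = g (ψ s) := rfl

end FShriek

end Shriek

namespace CartierStructure

variable {p : ℕ} {R : Type u} {M : Type v} [CommRing R] [AddCommGroup M] [Module R M]

/-- The adjoint structural map `C : M → F^! M`, `m ↦ [r ↦ κ (r m)]`. -/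
def adjoint (κ : CartierStructure p R M) : M →ₗ[R] FShriek p 1 R M where
  toFun m := ⟨κ.toAddMonoidHom.comp (AddMonoidHom.flip (smulAddHom R M) m), fun r s => by
    have h := κ.map_pow_smul r (s • m)
    rw [smul_smul] at h
    rw [pow_one]
    exact h⟩
  map_add' a b := by
    ext s
    exact (congrArg κ (smul_add s a b)).trans (map_add κ _ _)
  map_smul' r m := by
    ext s
    exact congrArg κ ((smul_smul s r m).trans (by rw [mul_comm]; rfl))

@[simp] theorem adjoint_apply (κ : CartierStructure p R M) (m : M) (s : R) :
    κ.adjoint m s = κ (s • m) := rfl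

/-- The Cartier structure of `F^{e!} M`: `ψ ↦ κ ∘ ψ ∘ F`. -/
def shriek [Fact p.Prime] [CharP R p] (κ : CartierStructure p R M) (e : ℕ) :
    CartierStructure p R (FShriek p e R M) where
  toFun ψ := ⟨(κ.toAddMonoidHom.comp ψ.1).comp (frobenius R p).toAddMonoidHom, fun r s => by
    have h := ψ.2 (r ^ p) (s ^ p)
    have h' := κ.map_pow_smul r (ψ.1 (s ^ p))
    rw [← h, pow_right_comm, ← mul_pow] at h'
    exact h'⟩
  map_zero' := by ext s; exact map_zero κ
  map_add' a b := by ext s; exact map_add κ _ _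
  map_pow_smul' r ψ := by
    ext s
    change κ (ψ (r ^ p * s ^ p)) = κ (ψ ((r * s) ^ p))
    rw [mul_pow]

@[simp] theorem shriek_apply [Fact p.Prime] [CharP R p] (κ : CartierStructure p R M) (e : ℕ)
    (ψ : FShriek p e R M) (s : R) : κ.shriek e ψ s = κ (ψ (s ^ p)) := rfl

/-- The maps `F^{i!} M → F^{j!} M` of the direct system, `ψ ↦ κ^(j-i) ∘ ψ`. For `j = i + 1` this
is `F^{i!} C`, where `F^{i!} F^! M` is identified with `F^{(i+1)!} M` by evaluation at `1`
(tensor-hom adjunction); it is also the adjoint structural map of the Cartier module `F^{i!} M`. -/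
def transition (κ : CartierStructure p R M) (i j : ℕ) (h : i ≤ j) :
    FShriek p i R M →ₗ[R] FShriek p j R M where
  toFun ψ := ⟨(κ.iter (j - i)).comp ψ.1, fun r s => by
    have h1 := ψ.2 (r ^ p ^ (j - i)) s
    have h2 := κ.iter_pow_smul (j - i) r (ψ.1 s)
    rw [← h1, ← pow_mul, ← pow_add, Nat.sub_add_cancel h] at h2
    exact h2⟩
  map_add' a b := by ext s; exact map_add (κ.iter (j - i)) (a s) (b s)
  map_smul' r m := rfl

@[simp] theorem transition_apply (κ : CartierStructure p R M) (i j : ℕ) (h : i ≤ j)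
    (ψ : FShriek p i R M) (s : R) : κ.transition i j h ψ s = κ.iter (j - i) (ψ s) := rfl

/-- The underlying `R`-module of `colim_e F^{e!} M`. -/
abbrev UnitModule (κ : CartierStructure p R M) : Type (max u v) :=
  Module.DirectLimit (fun e : ℕ => FShriek p e R M) κ.transition

/-- The canonical map `F^{e!} M → colim_e F^{e!} M`. -/
def toUnit (κ : CartierStructure p R M) (e : ℕ) : FShriek p e R M →ₗ[R] κ.UnitModule :=
  Module.DirectLimit.of R ℕ (fun e : ℕ => FShriek p e R M) κ.transition e

/-- The natural map `M → colim_e F^{e!} M`. -/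
def ofBase (κ : CartierStructure p R M) : M →ₗ[R] κ.UnitModule :=
  κ.toUnit 0 ∘ₗ FShriek.zeroEmb

theorem toUnit_transition (κ : CartierStructure p R M) (i j : ℕ) (h : i ≤ j)
    (ψ : FShriek p i R M) : κ.toUnit j (κ.transition i j h ψ) = κ.toUnit i ψ :=
  Module.DirectLimit.of_f

section

variable [Fact p.Prime] [CharP R p]

theorem transition_shriek (κ : CartierStructure p R M) (i j : ℕ) (h : i ≤ j)
    (ψ : FShriek p i R M) :
    κ.transition i j h (κ.shriek i ψ) = κ.shriek j (κ.transition i j h ψ) := by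
  ext s
  simp only [transition_apply, shriek_apply]
  rw [← iter_succ_apply, ← iter_succ_apply']

/-- The map `C : 𝓜 → F^! 𝓜` on `𝓜 = colim_e F^{e!} M` induced by the adjoint structural maps of
the Cartier modules `F^{e!} M`. -/
def unitAdjoint (κ : CartierStructure p R M) : κ.UnitModule →ₗ[R] FShriek p 1 R κ.UnitModule :=
  Module.DirectLimit.lift R ℕ (fun e : ℕ => FShriek p e R M) κ.transition
    (fun e => FShriek.map (κ.toUnit e) ∘ₗ (κ.shriek e).adjoint) (fun i j h ψ => by
      ext s
      simp only [LinearMap.comp_apply, FShriek.map_apply, adjoint_apply]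
      rw [← map_smul, ← transition_shriek, toUnit_transition])

theorem unitAdjoint_toUnit (κ : CartierStructure p R M) (e : ℕ) (ψ : FShriek p e R M) (s : R) :
    κ.unitAdjoint (κ.toUnit e ψ) s = κ.toUnit e (κ.shriek e (s • ψ)) := by
  have h : κ.unitAdjoint (κ.toUnit e ψ) =
      (FShriek.map (κ.toUnit e) ∘ₗ (κ.shriek e).adjoint) ψ :=
    Module.DirectLimit.lift_of (R := R) (ι := ℕ) (G := fun e : ℕ => FShriek p e R M)
      (f := κ.transition) (g := fun e => FShriek.map (κ.toUnit e) ∘ₗ (κ.shriek e).adjoint) ..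
  rw [h]
  rfl

/-- The Cartier structure on `colim_e F^{e!} M`; it corresponds to the map `C` above. -/
def unit (κ : CartierStructure p R M) : CartierStructure p R κ.UnitModule where
  toFun x := κ.unitAdjoint x 1
  map_zero' := by simp
  map_add' a b := by simp
  map_pow_smul' r x := by
    have h := FShriek.map_pow_mul (κ.unitAdjoint x) r 1
    rw [pow_one] at h
    simp [← h]

theorem unit_toUnit (κ : CartierStructure p R M) (e : ℕ) (ψ : FShriek p e R M) :
    κ.unit (κ.toUnit e ψ) = κ.toUnit e (κ.shriek e ψ) := by
  change κ.unitAdjoint (κ.toUnit e ψ) 1 = _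
  rw [unitAdjoint_toUnit, one_smul]

end

/-- `τ(𝓜, f^t)` for `𝓜 = colim_e F^{e!} M`: the image of `τ(M, f^t)` under `M → 𝓜`. -/
def unitTestModule (κ : CartierStructure p R M) (f : R) (t : ℚ≥0) : Submodule R κ.UnitModule :=
  (κ.testModule f t).map κ.ofBase

end CartierStructure

namespace CartierHom

variable {p : ℕ} {R : Type u} {M : Type v} {N : Type w} [CommRing R]
  [AddCommGroup M] [Module R M] [AddCommGroup N] [Module R N]
  {κM : CartierStructure p R M} {κN : CartierStructure p R N}

/-- The morphism of Cartier modules `colim_e F^{e!} M → colim_e F^{e!} N` induced by the maps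
`F^{e!} φ`. -/
def unit [Fact p.Prime] [CharP R p] (φ : CartierHom κM κN) : CartierHom κM.unit κN.unit where
  toLinearMap := Module.DirectLimit.map (fun _ => FShriek.map φ.toLinearMap) (fun i j h => by
    ext ψ s
    exact φ.map_iter (j - i) (ψ s))
  map_cartier' x := by
    induction x using Module.DirectLimit.induction_on with
    | ih e ψ =>
      change Module.DirectLimit.map _ _ (κM.unit (κM.toUnit e ψ)) =
        κN.unit (Module.DirectLimit.map _ _ (κM.toUnit e ψ))
      rw [CartierStructure.unit_toUnit]
      unfold CartierStructure.toUnit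
      rw [Module.DirectLimit.map_apply_of, Module.DirectLimit.map_apply_of]
      change _ = κN.unit (κN.toUnit e _)
      rw [CartierStructure.unit_toUnit]
      unfold CartierStructure.toUnit
      congr 1
      ext s
      exact φ.map_cartier _

end CartierHom

end CartierModule

end

/-! # Test module filtrations of unit Cartier modules

*Stationarity.* The chain `(C_+)^h M` is stationary by Gabber's argument, which only uses that `C_+`
is monotone and satisfies `x C_+ N ⊆ C_+ (x^p N)` (`CartierStructure.smul_mem_plus`): the ideals
`((C_+)^(h+1) M : (C_+)^h M)` increase, and at a minimal prime of their stable value the chain lives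
in a module of finite length.

*Existence of test modules.* Write `P = C_+ P` for the stable value. The same identity shows that
`c^n P ⊆ N` implies `c P ⊆ N` for `C`-submodules `N`. So it suffices to find, for each generic point
`η` of `P`, some `c ∉ η` a power of which multiplies `P` into `N` whenever `N` contains `P` at `η`
(`CartierStructure.exists_testElement`); then the intersection of all competing `N` is a competitor.
Modulo torsion and nilpotent elements, `P` becomes a torsion-free Cartier module `Λ` without
nilpotents over the `F`-finite domain `A = R / η`. Comparing ranks, `Λ → F^! Λ` is generically an
isomorphism. With a generic `p`-basis of `A` this means that the values `κ (a i • q)` can be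
prescribed, and then the ideal `J` of elements that multiply `Λ` into `N`, away from the zeros of a
fixed `c`, satisfies `c^p J ⊆ J^2`, so it contains a power of `c`
(`exists_pow_smul_mem_of_isDomain`).

*Nil-isomorphisms.* Powers of `C_+` neither see nilpotent kernels nor leave the image of a morphism
with nilpotent cokernel. So the stable values correspond under a nil-isomorphism, they have the same
generic points, and the test modules correspond (`CartierHom.map_testModule`). As `M → F^{e!} M` is
a nil-isomorphism of finitely generated modules, the filtration of the colimit can be computed from
any `F^{e!} M`. Finally the colimit inverts nil-isomorphisms, because its transition maps are
composition with powers of `κ`. -/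

noncomputable section

namespace CartierModule

/-! ### Stationary chains and the operator `C_+` -/

section Localization

variable {R M : Type*} [CommRing R] [AddCommGroup M] [Module R M]

theorem pow_smul_mem_of_le {N : Submodule R M} {x : R} {i j : ℕ} (hij : i ≤ j) {n : M}
    (hn : x ^ i • n ∈ N) : x ^ j • n ∈ N := by
  rw [← Nat.sub_add_cancel hij, pow_add, mul_smul]
  exact N.smul_mem _ hn

/-- A common denominator for a finitely generated submodule. -/
theorem exists_mem_forall_smul_mem {S : Submonoid R} {P Q : Submodule R M} (hP : P.FG)
    (h : ∀ x ∈ P, ∃ s ∈ S, s • x ∈ Q) : ∃ s ∈ S, ∀ x ∈ P, s • x ∈ Q := by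
  classical
  obtain ⟨T, rfl⟩ := hP
  choose! s hs hsx using h
  refine ⟨∏ y ∈ T, s y, prod_mem fun y hy => hs y (Submodule.subset_span hy), fun x hx => ?_⟩
  induction hx using Submodule.span_induction with
  | mem y hy =>
    rw [← Finset.prod_erase_mul T s hy, mul_smul]
    exact Q.smul_mem _ (hsx y (Submodule.subset_span hy))
  | zero => simp
  | add a b _ _ ha hb => rw [smul_add]; exact Q.add_mem ha hb
  | smul r a _ ha => rw [smul_comm]; exact Q.smul_mem r ha

theorem localized_le_localized_iff {S : Submonoid R} {P Q : Submodule R M} :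
    P.localized S ≤ Q.localized S ↔ ∀ x ∈ P, ∃ s ∈ S, s • x ∈ Q := by
  constructor
  · intro h x hx
    have h1 : IsLocalizedModule.mk' (LocalizedModule.mkLinearMap S M) x (1 : S) ∈
        Q.localized S := h ⟨x, hx, 1, rfl⟩
    obtain ⟨y, hy, s, hs⟩ := h1
    rw [IsLocalizedModule.mk'_eq_mk'_iff] at hs
    obtain ⟨t, ht⟩ := hs
    refine ⟨t * s, mul_mem t.2 s.2, ?_⟩
    have : (t * s : R) • x = (t : R) • y := by
      simpa [Submonoid.smul_def, mul_smul] using ht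
    rw [this]
    exact Q.smul_mem _ hy
  · rintro h _ ⟨x, hx, s, rfl⟩
    obtain ⟨t, ht, htx⟩ := h x hx
    exact ⟨t • x, htx, ⟨t, ht⟩ * s, by
      simpa [Submonoid.smul_def] using
        IsLocalizedModule.mk'_cancel_left (f := LocalizedModule.mkLinearMap S M) x ⟨t, ht⟩ s⟩

/-- At a minimal prime of `J` the module `M / J M` has finite length, so a decreasing chain of
submodules containing `J M` is stationary there. -/
theorem exists_smul_mem_succ_of_antitone [IsNoetherianRing R] [Module.Finite R M] {J 𝔭 : Ideal R}
    (h𝔭 : 𝔭 ∈ J.minimalPrimes) {X : ℕ → Submodule R M} (hX : Antitone X)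
    (hJ : ∀ n, ∀ r ∈ J, ∀ m : M, r • m ∈ X n) :
    ∃ n, ∃ s ∉ 𝔭, ∀ m ∈ X n, s • m ∈ X (n + 1) := by
  have hprime : 𝔭.IsPrime := h𝔭.1.1
  let A := Localization.AtPrime 𝔭
  let W := LocalizedModule 𝔭.primeCompl M
  let J' : Ideal A := J.map (algebraMap R A)
  have hmin : IsLocalRing.maximalIdeal A ∈ J'.minimalPrimes := by
    rw [IsLocalization.minimalPrimes_map 𝔭.primeCompl A J, Set.mem_preimage,
      IsLocalization.AtPrime.under_maximalIdeal A 𝔭]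
    exact h𝔭
  have : IsNoetherianRing A := IsLocalization.isNoetherianRing 𝔭.primeCompl A inferInstance
  -- `M_𝔭 / J M_𝔭` is Artinian, as a finite module over the Artinian ring `R_𝔭 / J R_𝔭`
  have hart : IsArtinianRing (A ⧸ J') :=
    IsLocalRing.quotient_artinian_of_mem_minimalPrimes_of_isLocalRing J' hmin
  let Q := W ⧸ (J' • ⊤ : Submodule A W)
  have : Module.Finite A W := Module.Finite.of_isLocalizedModule 𝔭.primeCompl
    (LocalizedModule.mkLinearMap 𝔭.primeCompl M)
  have : Module.Finite (A ⧸ J') Q := Module.Finite.of_restrictScalars_finite A _ _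
  have : IsArtinian (A ⧸ J') Q := inferInstance
  have : IsArtinian A Q :=
    isArtinian_of_surjective_algebraMap (S := A) (R := A ⧸ J') Ideal.Quotient.mk_surjective
  let Y : ℕ → Submodule A W := fun n => (X n).localized 𝔭.primeCompl
  have hY : Antitone Y := fun m n h => localized_le_localized_iff.mpr fun x hx =>
    ⟨1, one_mem _, by simpa using hX h hx⟩
  have hJY : ∀ n, J' • ⊤ ≤ Y n := by
    refine fun n => Submodule.smul_le.mpr fun r hr w _ => ?_
    suffices J' ≤ (Y n).comap (LinearMap.toSpanSingleton A W w) from this hr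
    refine Ideal.map_le_iff_le_comap.mpr fun r hr => ?_
    obtain ⟨⟨m, s⟩, rfl⟩ := IsLocalizedModule.mk'_surjective 𝔭.primeCompl
      (LocalizedModule.mkLinearMap 𝔭.primeCompl M) w
    refine ⟨r • m, hJ n r hr m, s, ?_⟩
    simp [IsLocalizedModule.mk'_smul]
  obtain ⟨n, hn⟩ := IsArtinian.monotone_stabilizes
    (⟨fun n => (Y n).map (Submodule.mkQ (J' • ⊤ : Submodule A W)),
      fun a b h => Submodule.map_mono (hY h)⟩ : ℕ →o (Submodule A Q)ᵒᵈ)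
  have h2 := congrArg (Submodule.comap (Submodule.mkQ (J' • ⊤ : Submodule A W)))
    (hn (n + 1) n.le_succ)
  have h3 : Y n = Y (n + 1) := by
    change ((Y n).map _).comap _ = ((Y (n + 1)).map _).comap _ at h2
    simpa [Submodule.comap_map_mkQ, sup_eq_right.mpr (hJY _)] using h2
  obtain ⟨s, hs, h⟩ := exists_mem_forall_smul_mem (IsNoetherian.noetherian (X n))
    (localized_le_localized_iff.mp h3.le)
  exact ⟨n, s, hs, h⟩

end Localization

namespace CartierStructure

variable {p : ℕ} {R M : Type*} [CommRing R] [AddCommGroup M] [Module R M]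
  (κ : CartierStructure p R M) (f : R) (t : ℚ≥0)

theorem iter_mem {N : Submodule R M} (hN : ∀ n ∈ N, κ n ∈ N) (e : ℕ) {n : M} (hn : n ∈ N) :
    κ.iter e n ∈ N := by
  induction e with
  | zero => exact hn
  | succ e ih => rw [iter_succ_apply]; exact hN _ ih

variable {f t} in
theorem iter_smul_mem_plus {N : Submodule R M} {e : ℕ} (he : 1 ≤ e) {n : M} (hn : n ∈ N) :
    κ.iter e (f ^ ⌈t * (p : ℚ≥0) ^ e⌉₊ • n) ∈ κ.plus f t N :=
  Submodule.subset_span ⟨e, he, n, hn, rfl⟩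

variable {κ f t} in
theorem plus_le_iff {N P : Submodule R M} :
    κ.plus f t N ≤ P ↔
      ∀ e, 1 ≤ e → ∀ n ∈ N, κ.iter e (f ^ ⌈t * (p : ℚ≥0) ^ e⌉₊ • n) ∈ P := by
  rw [plus, Submodule.span_le]
  constructor
  · exact fun h e he n hn => h ⟨e, he, n, hn, rfl⟩
  · rintro h _ ⟨e, he, n, hn, rfl⟩
    exact h e he n hn

variable {f t} in
theorem plus_mono : Monotone (κ.plus f t) := fun N P (h : N ≤ P) =>
  plus_le_iff.mpr fun _ he _ hn => κ.iter_smul_mem_plus he (h hn)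

variable {f t} in
/-- `x C_+ N ⊆ C_+ (x^p N)`, because `x κ^e = κ^e x^(p^e)`. -/
theorem smul_mem_plus {x : R} {N N' : Submodule R M} (h : ∀ n ∈ N, x ^ p • n ∈ N')
    {y : M} (hy : y ∈ κ.plus f t N) : x • y ∈ κ.plus f t N' := by
  suffices κ.plus f t N ≤ (κ.plus f t N').comap (LinearMap.lsmul R M x) from this hy
  refine plus_le_iff.mpr fun e he n hn => ?_
  change x • κ.iter e (f ^ ⌈t * (p : ℚ≥0) ^ e⌉₊ • n) ∈ κ.plus f t N'
  rw [← κ.iter_pow_smul, smul_comm]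
  exact κ.iter_smul_mem_plus he (pow_smul_mem_of_le (Nat.le_self_pow (by lia) p) (h n hn))

theorem plusPow_succ (h : ℕ) : κ.plusPow f t (h + 1) = κ.plus f t (κ.plusPow f t h) :=
  Function.iterate_succ_apply' _ _ _

theorem plusPow_zero : κ.plusPow f t 0 = ⊤ := rfl

theorem plusPow_antitone : Antitone (κ.plusPow f t) := by
  refine antitone_nat_of_succ_le fun h => ?_
  induction h with
  | zero => exact le_top
  | succ h ih =>
    exact (κ.plusPow_succ f t (h + 1)).le.trans
      ((κ.plus_mono ih).trans (κ.plusPow_succ f t h).ge)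

/-- The chain `(C_+)^h M` is stationary. The ideals `(C_+^(h+1) M : C_+^h M)` increase with `h`, so
they stabilize at some `I`. Squares of elements of `I` multiply the `h`-th term of the chain into
all later ones, so the chain is stationary at the minimal primes of `I`, unless there are none. -/
theorem exists_plusPow_eq [IsNoetherianRing R] [Module.Finite R M] (hp : 2 ≤ p) :
    ∃ h₀, ∀ h, h₀ ≤ h → κ.plusPow f t h = κ.plusPow f t h₀ := by
  set X := κ.plusPow f t with hXdef
  have hX : Antitone X := κ.plusPow_antitone f t
  let I : ℕ →o Ideal R := ⟨fun h => (X (h + 1)).colon (X h : Set M), monotone_nat_of_le_succ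
    fun h r hr => by
      rw [Submodule.mem_colon] at hr ⊢
      intro m hm
      rw [SetLike.mem_coe, hXdef, plusPow_succ] at hm
      rw [hXdef, plusPow_succ]
      refine κ.smul_mem_plus (fun n hn => ?_) hm
      refine pow_smul_mem_of_le (show 1 ≤ p by lia) ?_
      simpa using hr n hn⟩
  obtain ⟨h₀, hI⟩ := monotone_stabilizes_iff_noetherian.mpr ‹IsNoetherianRing R› I
  have hmem : ∀ h, h₀ ≤ h → ∀ r, r ∈ I h₀ ↔ ∀ m ∈ X h, r • m ∈ X (h + 1) := fun h hh r => by
    rw [hI h hh]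
    exact Submodule.mem_colon
  by_cases htop : I h₀ = ⊤
  · refine ⟨h₀, fun h hh => ?_⟩
    induction h, hh using Nat.le_induction with
    | base => rfl
    | succ h hh ih =>
      rw [← ih]
      refine le_antisymm (hX h.le_succ) fun m hm => ?_
      simpa using (hmem h hh 1).mp (htop ▸ Submodule.mem_top) m hm
  exfalso
  have hsq : ∀ r ∈ I h₀, ∀ n, ∀ m ∈ X h₀, r ^ 2 • m ∈ X (h₀ + n) := by
    intro r hr n
    induction n with
    | zero => exact fun m hm => Submodule.smul_mem _ _ hm
    | succ n ih =>
      intro m hm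
      have h1 := (hmem h₀ le_rfl r).mp hr m hm
      rw [hXdef, plusPow_succ] at h1
      rw [← add_assoc, hXdef, plusPow_succ, pow_two, mul_smul]
      refine κ.smul_mem_plus (fun n hn => ?_) h1
      exact pow_smul_mem_of_le hp (ih n hn)
  -- `J` has the same minimal primes as `I h₀`, and multiplies `X h₀` into every term of the chain
  let J : Ideal R := Ideal.span ((fun r => r ^ 2) '' (I h₀ : Set R))
  have hJI : J.radical = (I h₀).radical := by
    refine le_antisymm (Ideal.radical_mono ?_) (Ideal.radical_le_radical_iff.mpr fun r hr =>
      ⟨2, Ideal.subset_span ⟨r, hr, rfl⟩⟩)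
    rw [Ideal.span_le]
    rintro _ ⟨r, hr, rfl⟩
    exact Ideal.pow_mem_of_mem _ hr 2 two_pos
  obtain ⟨𝔭, h𝔭⟩ := Ideal.nonempty_minimalPrimes htop
  rw [← Ideal.radical_minimalPrimes, ← hJI, Ideal.radical_minimalPrimes] at h𝔭
  have hJX : ∀ n, ∀ r ∈ J, ∀ m : X h₀, r • m ∈ (X (h₀ + n)).comap (X h₀).subtype := by
    intro n r hr m
    have : J ≤ (X (h₀ + n)).colon (X h₀ : Set M) := by
      rw [Ideal.span_le]
      rintro _ ⟨r, hr, rfl⟩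
      exact Submodule.mem_colon.mpr (hsq r hr n)
    exact Submodule.mem_colon.mp (this hr) m m.2
  obtain ⟨n, s, hs, hsX⟩ := exists_smul_mem_succ_of_antitone h𝔭
    (X := fun n => (X (h₀ + n)).comap (X h₀).subtype)
    (fun a b hab => Submodule.comap_mono (hX (by lia))) hJX
  have hsI : s ∈ I h₀ := (hmem (h₀ + n) (by lia) s).mpr fun m hm =>
    hsX ⟨m, hX (by lia) hm⟩ hm
  have hIp : I h₀ ≤ 𝔭 := by
    rw [← Ideal.radical_minimalPrimes, hJI, Ideal.radical_minimalPrimes] at h𝔭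
    exact h𝔭.1.2
  exact hs (hIp hsI)

theorem eventually_plusPow_eq_underline [IsNoetherianRing R] [Module.Finite R M] (hp : 2 ≤ p) :
    ∀ᶠ h in Filter.atTop, κ.plusPow f t h = κ.underline f t := by
  obtain ⟨h₀, hh₀⟩ := κ.exists_plusPow_eq f t hp
  refine Filter.eventually_atTop.mpr ⟨h₀, fun h hh => le_antisymm (le_iInf fun n => ?_)
    (iInf_le _ h)⟩
  rw [hh₀ h hh, ← hh₀ (max h₀ n) (le_max_left _ _)]
  exact κ.plusPow_antitone f t (le_max_right _ _)

theorem plus_underline [IsNoetherianRing R] [Module.Finite R M] (hp : 2 ≤ p) :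
    κ.plus f t (κ.underline f t) = κ.underline f t := by
  obtain ⟨h₀, hh₀⟩ := Filter.eventually_atTop.mp (κ.eventually_plusPow_eq_underline f t hp)
  have h := κ.plusPow_succ f t h₀
  rwa [hh₀ h₀ le_rfl, hh₀ (h₀ + 1) (by lia), eq_comm] at h

end CartierStructure

/-! ### `F`-finite rings -/

/-- Finite type in terms of subrings, which avoids the two competing algebra structures of a ring
over itself when `f` is the Frobenius. -/
theorem _root_.RingHom.finiteType_iff_exists_finset {A B : Type*} [CommRing A] [CommRing B]
    (f : A →+* B) : f.FiniteType ↔ ∃ S : Finset B, ∀ T : Subring B, f.range ≤ T →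
      (S : Set B) ⊆ T → T = ⊤ := by
  let _ : Algebra A B := f.toAlgebra
  constructor
  · rintro ⟨S, hS⟩
    refine ⟨S, fun T hf hST => ?_⟩
    let T' : Subalgebra A B := { T with algebraMap_mem' := fun a => hf ⟨a, rfl⟩ }
    have h : T' = ⊤ := eq_top_iff.mpr (hS ▸ Algebra.adjoin_le hST)
    exact eq_top_iff.mpr fun b _ => show b ∈ T' from h ▸ Algebra.mem_top
  · rintro ⟨S, hS⟩
    refine ⟨S, eq_top_iff.mpr fun b _ => ?_⟩
    have h := hS (Algebra.adjoin A (S : Set B)).toSubring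
      (by rintro _ ⟨a, rfl⟩; exact (Algebra.adjoin A (S : Set B)).algebraMap_mem a)
      Algebra.subset_adjoin
    exact show b ∈ (Algebra.adjoin A (S : Set B)).toSubring from h ▸ Subring.mem_top b

theorem _root_.RingHom.Finite.exists_generators {A B : Type*} [CommRing A] [CommRing B]
    {f : A →+* B} (hf : f.Finite) :
    ∃ (n : ℕ) (g : Fin n → B), ∀ b, ∃ a : Fin n → A, ∑ i, f (a i) * g i = b := by
  let _ : Algebra A B := f.toAlgebra
  have : Module.Finite A B := hf
  obtain ⟨n, g, hg⟩ := Module.Finite.exists_fin (R := A) (M := B)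
  exact ⟨n, g, fun b => (Submodule.mem_span_range_iff_exists_fun A).mp (hg ▸ trivial)⟩

/-- A ring essentially of finite type over an `F`-finite field is `F`-finite. The Frobenius is
integral, and it is of finite type because `t⁻¹ = t^(p-1) (t⁻¹)^p`. -/
theorem frobenius_finite_of_essFiniteType {p : ℕ} [Fact p.Prime] {k R : Type*} [Field k]
    [CharP k p] (hk : (frobenius k p).Finite) [CommRing R] [CharP R p] [Algebra k R]
    [Algebra.EssFiniteType k R] : (frobenius R p).Finite := by
  classical
  have hp : 0 < p := (Fact.out : p.Prime).pos
  refine RingHom.IsIntegral.to_finite (fun x => ⟨Polynomial.X ^ p - Polynomial.C x,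
    Polynomial.monic_X_pow_sub_C x hp.ne', by simp [frobenius_def]⟩) ?_
  obtain ⟨σ, hσ⟩ := (Algebra.essFiniteType_iff k R).mp inferInstance
  obtain ⟨S, hS⟩ := (RingHom.finiteType_iff_exists_finset _).mp hk.finiteType
  refine (RingHom.finiteType_iff_exists_finset _).mpr
    ⟨S.image (algebraMap k R) ∪ σ, fun T hT hST => eq_top_iff.mpr fun x _ => ?_⟩
  have hST' : (∀ s ∈ S, algebraMap k R s ∈ T) ∧ ∀ s ∈ σ, s ∈ T :=
    ⟨fun s hs => hST (by simpa using Or.inl ⟨s, hs, rfl⟩), fun s hs => hST (by simp [hs])⟩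
  have hkT : T.comap (algebraMap k R) = ⊤ := by
    refine hS _ ?_ hST'.1
    rintro _ ⟨a, rfl⟩
    exact hT ⟨algebraMap k R a, by simp [frobenius_def]⟩
  have hadj : ∀ y ∈ Algebra.adjoin k (σ : Set R), y ∈ T := fun y hy => by
    induction hy using Algebra.adjoin_induction with
    | mem y hy => exact hST'.2 y hy
    | algebraMap r => exact show r ∈ T.comap (algebraMap k R) from hkT ▸ Subring.mem_top r
    | add a b _ _ ha hb => exact T.add_mem ha hb
    | mul a b _ _ ha hb => exact T.mul_mem ha hb
  obtain ⟨t, ht, ⟨u, rfl⟩, hxt⟩ := hσ x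
  have hinv : (↑u⁻¹ : R) = (u : R) ^ (p - 1) * frobenius R p (↑u⁻¹ : R) := by
    obtain ⟨l, rfl⟩ : ∃ l, p = l + 1 := ⟨p - 1, by lia⟩
    rw [frobenius_def, pow_succ, ← mul_assoc, Nat.add_sub_cancel, ← mul_pow]
    simp
  have hx : x = x * u * ↑u⁻¹ := by simp [mul_assoc]
  rw [hx, hinv]
  exact T.mul_mem (hadj _ hxt) (T.mul_mem (T.pow_mem (hadj _ ht) _) (hT ⟨_, rfl⟩))

theorem frobenius_finite_quotient {p : ℕ} [Fact p.Prime] {R : Type*} [CommRing R] [CharP R p]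
    (hR : (frobenius R p).Finite) (I : Ideal R) [CharP (R ⧸ I) p] :
    (frobenius (R ⧸ I) p).Finite := by
  have h : (frobenius (R ⧸ I) p).comp (Ideal.Quotient.mk I) =
      (Ideal.Quotient.mk I).comp (frobenius R p) := by
    ext x
    simp [frobenius_def]
  refine RingHom.Finite.of_comp_finite (f := Ideal.Quotient.mk I) ?_
  rw [h]
  exact (RingHom.Finite.of_surjective _ Ideal.Quotient.mk_surjective).comp hR

theorem iterateFrobenius_finite {p : ℕ} [Fact p.Prime] {R : Type*} [CommRing R] [CharP R p]
    (hR : (frobenius R p).Finite) (e : ℕ) : (iterateFrobenius R p e).Finite := by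
  induction e with
  | zero => simpa using RingHom.Finite.id R
  | succ e ih =>
    rw [iterateFrobenius_add, iterateFrobenius_one]
    exact ih.comp hR

/-! ### Generic `F`-regularity over domains -/

/-- `F_* M`: the additive group `M`, as a type synonym on which `r : R` acts as `r ^ p`. The prime
and the ring are recorded in the type for instance search. -/
def FStar (_p : ℕ) (_R M : Type*) : Type _ := M

namespace FStar

variable {p : ℕ} {R M : Type*}

instance [AddCommGroup M] : AddCommGroup (FStar p R M) := inferInstanceAs (AddCommGroup M)

variable (p R) in
/-- The identity `M = F_* M`. -/
def of [AddCommGroup M] : M ≃+ FStar p R M := AddEquiv.refl M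

variable [Fact p.Prime] [CommRing R] [CharP R p] [AddCommGroup M] [Module R M]

instance : Module R (FStar p R M) := Module.compHom M (frobenius R p)

end FStar

/-- Linearly independent elements in the largest possible number span a submodule whose quotient is
torsion, hence killed by a single element. -/
theorem exists_smul_mem_span_of_linearIndependent {A W ι : Type*} [CommRing A] [IsDomain A]
    [AddCommGroup W] [Module A W] [Module.Finite A W] [Fintype ι] {v : ι → W}
    (hv : LinearIndependent A v) (hcard : Module.finrank A W ≤ Fintype.card ι) :
    ∃ c : A, c ≠ 0 ∧ ∀ w : W, c • w ∈ Submodule.span A (Set.range v) := by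
  set L := Submodule.span A (Set.range v)
  have h1 : Module.finrank A L = Fintype.card ι := finrank_span_eq_card hv
  have h2 : Module.finrank A (W ⧸ L) = 0 := by
    have := Submodule.finrank_quotient_add_finrank L
    lia
  obtain ⟨c, hc, hc0⟩ := Submodule.annihilator_top_inter_nonZeroDivisors
    (Module.finrank_eq_zero_iff_isTorsion.mp h2)
  refine ⟨c, nonZeroDivisors.ne_zero hc0, fun w => ?_⟩
  have := Submodule.mem_annihilator.mp hc (L.mkQ w) trivial
  rwa [← map_smul, Submodule.mkQ_apply, Submodule.Quotient.mk_eq_zero] at this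

section Domain

variable {p : ℕ} [Fact p.Prime] {A Λ : Type*} [CommRing A] [IsDomain A] [CharP A p]
  [AddCommGroup Λ] [Module A Λ] [Module.Finite A Λ] [Module.IsTorsionFree A Λ]

omit [IsDomain A] in
theorem FStar.finite (hA : (frobenius A p).Finite) : Module.Finite A (FStar p A A) := by
  obtain ⟨n, g, hg⟩ := hA.exists_generators
  refine Module.Finite.of_surjective (Fintype.linearCombination A fun i => of p A (g i)) fun y => ?_
  obtain ⟨r, hr⟩ := hg ((of p A).symm y)
  exact ⟨r, hr⟩

theorem finrank_pi_le_of_isDomain {A Λ ι : Type*} [CommRing A] [IsDomain A]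
    [AddCommGroup Λ] [Module A Λ] [Module.Finite A Λ] [Fintype ι] :
    Module.finrank A (ι → Λ) ≤ Fintype.card ι * Module.finrank A Λ := by
  classical
  obtain ⟨b, hb⟩ := exists_linearIndependent_of_le_finrank (le_refl (Module.finrank A Λ))
  obtain ⟨d, hd, h⟩ := exists_smul_mem_span_of_linearIndependent hb (by simp)
  let v : ι × Fin (Module.finrank A Λ) → ι → Λ := fun x => Pi.single x.1 (b x.2)
  set L := Submodule.span A (Set.range v)
  have h1 : Module.finrank A L ≤ Fintype.card ι * Module.finrank A Λ := by
    have := finrank_range_le_card (R := A) v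
    rwa [Fintype.card_prod, Fintype.card_fin] at this
  have hmem : ∀ w : ι → Λ, d • w ∈ L := fun w => by
    have hw : d • w = ∑ i, LinearMap.single A (fun _ : ι => Λ) i (d • w i) :=
      (Finset.univ_sum_single (d • w)).symm
    rw [hw]
    refine L.sum_mem fun i _ => ?_
    suffices Submodule.span A (Set.range b) ≤ L.comap (LinearMap.single A (fun _ : ι => Λ) i) from
      this (h (w i))
    rw [Submodule.span_le]
    rintro _ ⟨j, rfl⟩
    exact Submodule.subset_span ⟨(i, j), rfl⟩
  have h2 : Module.finrank A ((ι → Λ) ⧸ L) = 0 := Module.IsTorsion.finrank_eq_zero fun {x} => by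
    obtain ⟨w, rfl⟩ := L.mkQ_surjective x
    refine ⟨⟨d, mem_nonZeroDivisors_of_ne_zero hd⟩, ?_⟩
    change d • L.mkQ w = 0
    rw [← map_smul, Submodule.mkQ_apply, Submodule.Quotient.mk_eq_zero]
    exact hmem w
  have := Submodule.finrank_quotient_add_finrank L
  lia

/-- Over an `F`-finite domain `A` there are elements `a i` that form a basis of `Frac A` over its
`p`-th powers, and `c` clears the denominators of the coordinates of all elements of `A`. -/
theorem exists_generic_pBasis (hA : (frobenius A p).Finite) :
    ∃ (ι : Type) (_ : Fintype ι) (a : ι → A) (c : A), c ≠ 0 ∧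
      (∀ r : ι → A, ∑ i, r i ^ p * a i = 0 → r = 0) ∧
      ∀ y : A, ∃ r : ι → A, c ^ p * y = ∑ i, r i ^ p * a i := by
  have := FStar.finite hA
  obtain ⟨a, ha⟩ := exists_linearIndependent_of_le_finrank
    (le_refl (Module.finrank A (FStar p A A)))
  obtain ⟨c, hc, h⟩ := exists_smul_mem_span_of_linearIndependent ha (by simp)
  refine ⟨_, inferInstance, fun i => (FStar.of p A).symm (a i), c, hc, fun r hr => ?_, fun y => ?_⟩
  · funext i
    exact Fintype.linearIndependent_iff.mp ha r hr i
  · obtain ⟨r, hr⟩ := (Submodule.mem_span_range_iff_exists_fun A).mp (h (FStar.of p A y))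
    exact ⟨r, hr.symm⟩

omit [Module.IsTorsionFree A Λ] in
/-- If no nonzero `q` is killed by all `κ (a i • ·)`, where the `a i` are linearly independent over
the `p`-th powers, then the map `F_* Λ → Λ^ι`, `q ↦ (κ (a i • q))_i`, is generically surjective:
it is injective, and `F_* Λ` has rank at least `card ι * rank Λ`. For a generic `p`-basis this says
that the adjoint map `Λ → F^! Λ` is generically an isomorphism. -/
theorem exists_smul_eq_of_forall_smul (κ : CartierStructure p A Λ) {ι : Type*} [Fintype ι]
    {a : ι → A} (ha : ∀ r : ι → A, ∑ i, r i ^ p * a i = 0 → r = 0)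
    (hinj : ∀ q, (∀ i, κ (a i • q) = 0) → q = 0) :
    ∃ c : A, c ≠ 0 ∧ ∀ w : ι → Λ, ∃ q, ∀ i, κ (a i • q) = c • w i := by
  obtain ⟨b, hb⟩ := exists_linearIndependent_of_le_finrank
    (le_refl (Module.finrank A Λ))
  let T : FStar p A Λ →ₗ[A] ι → Λ :=
    { toFun := fun q i => κ (a i • (FStar.of p A).symm q)
      map_add' := fun x y => by ext i; simp
      map_smul' := fun r x => by
        ext i
        exact (congrArg κ (smul_comm (a i) (r ^ p) _)).trans (κ.map_pow_smul r _) }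
  have hT : LinearMap.ker T = ⊥ := LinearMap.ker_eq_bot'.mpr fun q hq =>
    hinj q fun i => congrFun hq i
  have hab : LinearIndependent A
      fun x : ι × Fin (Module.finrank A Λ) => FStar.of p A (a x.1 • b x.2) := by
    refine Fintype.linearIndependent_iff.mpr fun r hr => ?_
    have h1 : ∑ j, (∑ i, r (i, j) ^ p * a i) • b j = 0 := by
      simp_rw [Finset.sum_smul, mul_smul]
      rw [Finset.sum_comm, ← Fintype.sum_prod_type']
      exact hr
    rintro ⟨i, j⟩
    exact congrFun (ha (fun i => r (i, j)) (Fintype.linearIndependent_iff.mp hb _ h1 j)) i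
  obtain ⟨c, hc, h⟩ := exists_smul_mem_span_of_linearIndependent (hab.map' T hT)
    (by simpa using finrank_pi_le_of_isDomain)
  refine ⟨c, hc, fun w => ?_⟩
  have hw : Submodule.span A (Set.range (T ∘ fun x : ι × Fin (Module.finrank A Λ) =>
      FStar.of p A (a x.1 • b x.2))) ≤ LinearMap.range T := by
    rw [Submodule.span_le]
    rintro _ ⟨x, rfl⟩
    exact ⟨_, rfl⟩
  obtain ⟨q, hq⟩ := hw (h w)
  exact ⟨q, fun i => congrFun hq i⟩

/-- Generic `F`-regularity of a Cartier module without nilpotents: away from a single `c ≠ 0`, a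
Cartier submodule of full rank is everything.

Let `J` be the ideal of those `y` that multiply `Λ` into `N` up to powers of `c`. The coordinates of
`y ∈ J` with respect to a generic `p`-basis lie in `J` as well, since one can prescribe all
`κ (a i • q)`. Hence `c^p J ⊆ J^2`, and `J` contains a power of `c` by the Cayley–Hamilton
theorem. -/
theorem exists_pow_smul_mem_of_isDomain [IsNoetherianRing A] (hA : (frobenius A p).Finite)
    (κ : CartierStructure p A Λ) (hnil : ∀ q, (∀ a : A, κ (a • q) = 0) → q = 0) :
    ∃ c : A, c ≠ 0 ∧ ∀ N : Submodule A Λ, (∀ n ∈ N, κ n ∈ N) →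
      (∃ x : A, x ≠ 0 ∧ ∀ m, x • m ∈ N) → ∃ k : ℕ, ∀ m, c ^ k • m ∈ N := by
  classical
  have hp : 2 ≤ p := (Fact.out : p.Prime).two_le
  obtain ⟨ι, _, a, c₁, hc₁, ha, hspan⟩ := exists_generic_pBasis (p := p) hA
  obtain ⟨c₂, hc₂, hsurj⟩ := exists_smul_eq_of_forall_smul κ ha fun q hq => hnil q fun y => by
    obtain ⟨r, hr⟩ := hspan y
    have h1 : c₁ • κ (y • q) = 0 := by
      rw [← κ.map_pow_smul, ← mul_smul, hr, Finset.sum_smul, map_sum]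
      refine Finset.sum_eq_zero fun i _ => ?_
      rw [mul_smul, κ.map_pow_smul, hq, smul_zero]
    exact (smul_eq_zero.mp h1).resolve_left hc₁
  set c := c₁ * c₂ with hcdef
  refine ⟨c, mul_ne_zero hc₁ hc₂, fun N hN ⟨x, hx, hxN⟩ => ?_⟩
  let J : Ideal A :=
    { carrier := {y | ∃ k : ℕ, ∀ m, (c ^ k * y) • m ∈ N}
      zero_mem' := ⟨0, by simp⟩
      add_mem' := by
        rintro y z ⟨k, hk⟩ ⟨l, hl⟩
        refine ⟨k + l, fun m => ?_⟩
        rw [show c ^ (k + l) * (y + z) = c ^ l * (c ^ k * y) + c ^ k * (c ^ l * z) by ring,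
          add_smul, mul_smul (c ^ l), mul_smul (c ^ k) (c ^ l * z)]
        exact N.add_mem (N.smul_mem _ (hk m)) (N.smul_mem _ (hl m))
      smul_mem' := by
        rintro r y ⟨k, hk⟩
        refine ⟨k, fun m => ?_⟩
        rw [smul_eq_mul, mul_left_comm, mul_smul]
        exact N.smul_mem _ (hk m) }
  have hxJ : x ∈ J := ⟨0, by simpa using hxN⟩
  have key : ∀ y ∈ J, c ^ p * y ∈ J * J := by
    rintro y ⟨k, hk⟩
    obtain ⟨r, hr⟩ := hspan y
    have hr' : c ^ p * y = ∑ i, c₂ ^ p * a i * r i ^ p := by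
      rw [hcdef, mul_pow, mul_right_comm, hr, Finset.sum_mul]
      exact Finset.sum_congr rfl fun i _ => by ring
    rw [hr']
    refine Ideal.sum_mem _ fun i _ => Ideal.mul_mem_left _ _ ?_
    have hri : r i ∈ J := by
      refine ⟨k + 1, fun w => ?_⟩
      obtain ⟨q, hq⟩ := hsurj (Pi.single i w)
      have h1 : κ ((c ^ k) ^ p • (c₁ ^ p * y) • q) = c ^ k • c₂ • r i • w := by
        rw [κ.map_pow_smul, hr, Finset.sum_smul, map_sum, Finset.sum_eq_single i]
        · rw [mul_smul, κ.map_pow_smul, hq, Pi.single_eq_same, smul_comm (r i)]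
        · intro j _ hj
          rw [mul_smul, κ.map_pow_smul, hq, Pi.single_eq_of_ne hj, smul_zero, smul_zero]
        · simp
      have h2 : (c ^ k) ^ p • (c₁ ^ p * y) • q ∈ N := by
        obtain ⟨l, rfl⟩ : ∃ l, p = l + 1 := ⟨p - 1, by lia⟩
        rw [← mul_smul, show (c ^ k) ^ (l + 1) * (c₁ ^ (l + 1) * y) =
          ((c ^ k) ^ l * c₁ ^ (l + 1)) * (c ^ k * y) by ring, mul_smul]
        exact N.smul_mem _ (hk q)
      have h3 := N.smul_mem c₁ (hN _ h2)
      rw [h1] at h3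
      convert h3 using 1
      rw [hcdef]
      simp only [← mul_smul]
      congr 1
      ring
    rw [← pow_two]
    exact Ideal.pow_le_pow_right hp (Ideal.pow_mem_pow hri p)
  obtain ⟨P, hPmonic, -, hPcoeff, hP⟩ :=
    LinearMap.exists_monic_and_natDegree_eq_and_coeff_mem_pow_and_aeval_eq_zero A
      (LinearMap.lsmul A J (c ^ p)) J (by
        rintro _ ⟨y, rfl⟩
        have h : (Submodule.map J.subtype (J • ⊤ : Submodule A J)) = J * J := by
          rw [Submodule.map_smul'', Submodule.map_top, Submodule.range_subtype, smul_eq_mul]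
        have h1 := key y y.2
        rw [← h] at h1
        obtain ⟨z, hz, hzy⟩ := h1
        have h2 : LinearMap.lsmul A J (c ^ p) y = z := Subtype.ext hzy.symm
        rwa [h2])
  have hPe : P.eval (c ^ p) = 0 := by
    have h1 := LinearMap.congr_fun hP ⟨x, hxJ⟩
    have h2 : LinearMap.lsmul A J (c ^ p) = algebraMap A (Module.End A J) (c ^ p) := rfl
    rw [h2, Polynomial.aeval_algebraMap_apply, Module.algebraMap_end_apply] at h1
    have h3 : P.eval (c ^ p) * x = 0 := by simpa using congrArg Subtype.val h1
    exact (mul_eq_zero.mp h3).resolve_right hx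
  have hcJ : (c ^ p) ^ P.natDegree ∈ J := by
    rw [Polynomial.eval_eq_sum_range, Finset.sum_range_succ, hPmonic.coeff_natDegree,
      one_mul] at hPe
    rw [eq_neg_of_add_eq_zero_right hPe]
    refine J.neg_mem (Ideal.sum_mem _ fun i hi => Ideal.mul_mem_right _ _ ?_)
    exact Ideal.pow_le_self (by have := Finset.mem_range.mp hi; lia) (hPcoeff i)
  obtain ⟨k, hk⟩ := hcJ
  refine ⟨k + p * P.natDegree, fun m => ?_⟩
  rw [pow_add, pow_mul]
  exact hk m

end Domain

/-! ### Generic `F`-regularity along a prime -/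

namespace CartierStructure

variable {p : ℕ} {R M : Type*} [CommRing R] [AddCommGroup M] [Module R M]

/-- The Cartier structure induced on the quotient by a Cartier submodule. -/
def quot (κ : CartierStructure p R M)
    (L : Submodule R M) (hL : ∀ m ∈ L, κ m ∈ L) : CartierStructure p R (M ⧸ L) where
  toAddMonoidHom := QuotientAddGroup.map _ _ κ.toAddMonoidHom hL
  map_pow_smul' r n := by
    obtain ⟨n, rfl⟩ := Submodule.Quotient.mk_surjective _ n
    exact congrArg Submodule.Quotient.mk (κ.map_pow_smul r n)

theorem quot_mk (κ : CartierStructure p R M) (L : Submodule R M) (hL : ∀ m ∈ L, κ m ∈ L) (m : M) :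
    κ.quot L hL (Submodule.Quotient.mk m) = Submodule.Quotient.mk (κ m) := rfl

end CartierStructure

section Prime

variable {p : ℕ} [Fact p.Prime] {R : Type*} [CommRing R] [CharP R p] [IsNoetherianRing R]

/-- The version of `exists_pow_smul_mem_of_isDomain` for an `R`-module that is a torsion-free module
over the domain `R ⧸ 𝔭`. -/
theorem exists_pow_smul_mem_of_isTorsionFree (hR : (frobenius R p).Finite) {Λ : Type*}
    [AddCommGroup Λ] [Module R Λ] [Module.Finite R Λ] (𝔭 : Ideal R) [𝔭.IsPrime]
    (h𝔭 : ∀ x ∈ 𝔭, ∀ m : Λ, x • m = 0) (htf : ∀ r ∉ 𝔭, ∀ m : Λ, r • m = 0 → m = 0)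
    (κ : CartierStructure p R Λ) (hnil : ∀ q, (∀ a : R, κ (a • q) = 0) → q = 0) :
    ∃ c ∉ 𝔭, ∀ N : Submodule R Λ, (∀ n ∈ N, κ n ∈ N) →
      (∃ x ∉ 𝔭, ∀ m, x • m ∈ N) → ∃ k : ℕ, ∀ m, c ^ k • m ∈ N := by
  have htors : Module.IsTorsionBySet R Λ 𝔭 := fun m x => h𝔭 x x.2 m
  let _ : Module (R ⧸ 𝔭) Λ := htors.module
  have hsmul : ∀ (r : R) (m : Λ), Ideal.Quotient.mk 𝔭 r • m = r • m := fun r m =>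
    htors.mk_smul r m
  have : IsScalarTower R (R ⧸ 𝔭) Λ := ⟨fun r a m => by
    obtain ⟨a, rfl⟩ := Ideal.Quotient.mk_surjective a
    rw [hsmul, ← smul_smul r a m |>.symm, ← hsmul (r * a)]
    rfl⟩
  have : Module.Finite (R ⧸ 𝔭) Λ := Module.Finite.of_restrictScalars_finite R _ _
  have hmk : ∀ r : R, Ideal.Quotient.mk 𝔭 r ≠ 0 ↔ r ∉ 𝔭 := fun r =>
    Ideal.Quotient.eq_zero_iff_mem.not
  have : Module.IsTorsionFree (R ⧸ 𝔭) Λ := by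
    refine Module.isTorsionFree_iff_smul_eq_zero.mpr fun a m h => ?_
    obtain ⟨a, rfl⟩ := Ideal.Quotient.mk_surjective a
    rw [hsmul] at h
    by_cases ha : a ∈ 𝔭
    · exact Or.inl (Ideal.Quotient.eq_zero_iff_mem.mpr ha)
    · exact Or.inr (htf a ha m h)
  have : CharP (R ⧸ 𝔭) p := (CharP.charP_iff_prime_eq_zero Fact.out).mpr (by
    rw [← map_natCast (Ideal.Quotient.mk 𝔭), CharP.cast_eq_zero, map_zero])
  let κ' : CartierStructure p (R ⧸ 𝔭) Λ :=
    { toAddMonoidHom := κ.toAddMonoidHom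
      map_pow_smul' := fun a m => by
        obtain ⟨a, rfl⟩ := Ideal.Quotient.mk_surjective a
        rw [← map_pow, hsmul, hsmul]
        exact κ.map_pow_smul a m }
  obtain ⟨c, hc, h⟩ := exists_pow_smul_mem_of_isDomain (frobenius_finite_quotient hR 𝔭) κ'
    fun q hq => hnil q fun a => by
      have := hq (Ideal.Quotient.mk 𝔭 a)
      rwa [hsmul] at this
  obtain ⟨c, rfl⟩ := Ideal.Quotient.mk_surjective c
  refine ⟨c, (hmk c).mp hc, fun N hN ⟨x, hx, hxN⟩ => ?_⟩
  let N' : Submodule (R ⧸ 𝔭) Λ :=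
    { N with
      smul_mem' := fun a m hm => by
        obtain ⟨a, rfl⟩ := Ideal.Quotient.mk_surjective a
        rw [hsmul]
        exact N.smul_mem a hm }
  obtain ⟨k, hk⟩ := h N' hN ⟨Ideal.Quotient.mk 𝔭 x, (hmk x).mpr hx, fun m => by
    rw [hsmul]; exact hxN m⟩
  refine ⟨k, fun m => ?_⟩
  have := hk m
  rwa [← map_pow, hsmul] at this

/-- Generic `F`-regularity along `𝔭` of a Cartier module whose structural map is surjective at `𝔭`
and which is killed by `𝔭` at `𝔭`.

The elements that are nilpotent and those that vanish at `𝔭` form a Cartier submodule `L`, and the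
previous result applies to `P / L`. Since a power `κ^e` maps `L` into the elements that vanish at
`𝔭`, an inclusion `c^k P ⊆ N + L` becomes `s₀ c^k κ^e P ⊆ N`, and `κ^e P` contains `s^e P`. -/
theorem exists_pow_smul_mem_of_surjective (hR : (frobenius R p).Finite) {P : Type*}
    [AddCommGroup P] [Module R P] [Module.Finite R P] (𝔭 : Ideal R) [𝔭.IsPrime]
    {u s : R} (hu : u ∉ 𝔭) (hu𝔭 : ∀ x ∈ 𝔭, ∀ m : P, u • x • m = 0)
    (κ : CartierStructure p R P) (hs : s ∉ 𝔭) (hsκ : ∀ m, ∃ m', κ m' = s • m) :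
    ∃ c ∉ 𝔭, ∀ N : Submodule R P, (∀ n ∈ N, κ n ∈ N) →
      (∃ x ∉ 𝔭, ∀ m, x • m ∈ N) → ∃ k : ℕ, ∀ m, c ^ k • m ∈ N := by
  have hp : p ≠ 0 := (Fact.out : p.Prime).ne_zero
  -- the elements that vanish at `𝔭`
  let T : Submodule R P := Submodule.torsion' R P 𝔭.primeCompl
  have hT : ∀ m, m ∈ T ↔ ∃ r ∉ 𝔭, r • m = 0 := fun m =>
    ⟨fun ⟨r, hr⟩ => ⟨r, r.2, hr⟩, fun ⟨r, hr, h⟩ => ⟨⟨r, hr⟩, h⟩⟩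
  have hTsat : ∀ r ∉ 𝔭, ∀ m, r • m ∈ T → m ∈ T := fun r hr m hm => by
    obtain ⟨r', hr', h⟩ := (hT _).mp hm
    exact (hT m).mpr ⟨r' * r, 𝔭.primeCompl.mul_mem hr' hr, by rw [mul_smul, h]⟩
  have hTκ : ∀ m ∈ T, κ m ∈ T := fun m hm => by
    obtain ⟨r, hr, h⟩ := (hT m).mp hm
    refine (hT _).mpr ⟨r, hr, ?_⟩
    have h1 : r ^ p • m ∈ (⊥ : Submodule R P) :=
      pow_smul_mem_of_le (Nat.one_le_iff_ne_zero.mpr hp) (by simpa using h)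
    rw [← κ.map_pow_smul, (Submodule.mem_bot R).mp h1, map_zero]
  obtain ⟨s₀, hs₀, hs₀T⟩ : ∃ s ∈ 𝔭.primeCompl, ∀ m ∈ T, s • m ∈ (⊥ : Submodule R P) :=
    exists_mem_forall_smul_mem (IsNoetherian.noetherian T) fun m hm => by
      simpa using (hT m).mp hm
  -- the union `L e` of this chain is the module of elements that are nilpotent at `𝔭`
  let L : ℕ →o Submodule R P := ⟨fun e =>
    { carrier := {m | ∀ a : R, κ.iter e (a • m) ∈ T}
      zero_mem' := by simp
      add_mem' := fun hx hy a => by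
        rw [smul_add, map_add]
        exact T.add_mem (hx a) (hy a)
      smul_mem' := fun r x hx a => by
        rw [smul_smul]
        exact hx (a * r) }, monotone_nat_of_le_succ fun e m hm a => by
          rw [CartierStructure.iter_succ_apply]
          exact hTκ _ (hm a)⟩
  obtain ⟨e, he⟩ := monotone_stabilizes_iff_noetherian.mpr
    (inferInstance : IsNoetherian R P) L
  have hL : ∀ m, m ∈ L e ↔ ∀ a : R, κ.iter e (a • m) ∈ T := fun m => Iff.rfl
  have hL' : ∀ m, m ∈ L e ↔ ∀ a : R, κ.iter (e + 1) (a • m) ∈ T := fun m => by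
    rw [he (e + 1) e.le_succ]; exact Iff.rfl
  have hLκ : ∀ m ∈ L e, κ m ∈ L e := fun m hm a => by
    rw [← κ.map_pow_smul, ← CartierStructure.iter_succ_apply']
    exact (hL' m).mp hm _
  obtain ⟨c, hc, h⟩ := exists_pow_smul_mem_of_isTorsionFree hR 𝔭 (Λ := P ⧸ L e)
    (fun x hx m => by
      obtain ⟨m, rfl⟩ := Submodule.Quotient.mk_surjective _ m
      rw [← Submodule.Quotient.mk_smul, Submodule.Quotient.mk_eq_zero]
      have h0 : x • m ∈ L 0 := fun a => (hT _).mpr ⟨u, hu, by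
        change u • a • x • m = 0
        rw [smul_comm a, hu𝔭 x hx]⟩
      exact L.monotone e.zero_le h0)
    (fun r hr m h => by
      obtain ⟨m, rfl⟩ := Submodule.Quotient.mk_surjective _ m
      rw [← Submodule.Quotient.mk_smul, Submodule.Quotient.mk_eq_zero] at h
      rw [Submodule.Quotient.mk_eq_zero]
      intro a
      refine hTsat r hr _ ?_
      rw [← κ.iter_pow_smul]
      have := h (r ^ (p ^ e - 1) * a)
      rwa [smul_smul, mul_right_comm, ← pow_succ, Nat.sub_add_cancel
        (Nat.one_le_iff_ne_zero.mpr (pow_ne_zero _ hp)), mul_smul] at this)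
    (κ.quot (L e) hLκ) (fun q hq => by
      obtain ⟨q, rfl⟩ := Submodule.Quotient.mk_surjective _ q
      rw [Submodule.Quotient.mk_eq_zero, hL']
      intro a
      have := hq a
      rw [← Submodule.Quotient.mk_smul, CartierStructure.quot_mk,
        Submodule.Quotient.mk_eq_zero] at this
      simpa [CartierStructure.iter_succ_apply'] using this 1)
  have hse : ∀ j m, ∃ m', κ.iter j m' = s ^ j • m := by
    intro j
    induction j with
    | zero => exact fun m => ⟨m, by simp [CartierStructure.iter]⟩
    | succ j ih =>
      intro m
      obtain ⟨m₁, h₁⟩ := ih m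
      obtain ⟨m₂, h₂⟩ := hsκ (s ^ (p ^ j - 1) • m₁)
      refine ⟨m₂, ?_⟩
      rw [CartierStructure.iter_succ_apply', h₂, ← mul_smul, ← pow_succ', Nat.sub_add_cancel
        (Nat.one_le_iff_ne_zero.mpr (pow_ne_zero _ hp)), κ.iter_pow_smul, h₁, ← mul_smul,
        ← pow_succ']
  refine ⟨c * s * s₀, 𝔭.primeCompl.mul_mem (𝔭.primeCompl.mul_mem hc hs) hs₀,
    fun N hN ⟨x, hx, hxN⟩ => ?_⟩
  obtain ⟨k, hk⟩ := h (N.map (L e).mkQ)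
    (by
      rintro _ ⟨n, hn, rfl⟩
      exact ⟨κ n, hN n hn, rfl⟩)
    ⟨x, hx, fun m => by
      obtain ⟨m, rfl⟩ := Submodule.Quotient.mk_surjective _ m
      exact ⟨x • m, hxN m, rfl⟩⟩
  have main : ∀ m, (s₀ * c ^ k * s ^ e) • m ∈ N := fun m => by
    obtain ⟨m', hm'⟩ := hse e m
    rw [mul_smul, ← hm', mul_smul, ← κ.iter_pow_smul]
    have h1 : Submodule.Quotient.mk ((c ^ k) ^ p ^ e • m') ∈ N.map (L e).mkQ := by
      rw [← Nat.sub_add_cancel (Nat.one_le_iff_ne_zero.mpr (pow_ne_zero e hp)), pow_succ,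
        mul_smul, Submodule.Quotient.mk_smul, Submodule.Quotient.mk_smul]
      exact Submodule.smul_mem _ _ (hk _)
    obtain ⟨n, hn, hnm⟩ := h1
    have h2 : (c ^ k) ^ p ^ e • m' - n ∈ L e := by
      rw [← Submodule.Quotient.mk_eq_zero, Submodule.Quotient.mk_sub, ← hnm]
      simp
    have h3 : κ.iter e ((c ^ k) ^ p ^ e • m' - n) ∈ T := by simpa using h2 1
    have h4 := hs₀T _ h3
    rw [Submodule.mem_bot, map_sub, smul_sub, sub_eq_zero] at h4
    rw [h4]
    exact N.smul_mem _ (κ.iter_mem hN e hn)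
  refine ⟨k + e + 1, fun m => ?_⟩
  rw [show (c * s * s₀) ^ (k + e + 1) =
    (c ^ (e + 1) * s ^ (k + 1) * s₀ ^ (k + e)) * (s₀ * c ^ k * s ^ e) by ring, mul_smul]
  exact N.smul_mem _ (main m)

end Prime

/-! ### Existence of test modules -/

theorem genericallyAgree_iff {R M : Type*} [CommRing R] [AddCommGroup M] [Module R M]
    {N P : Submodule R M} : CartierStructure.GenericallyAgree N P ↔
      ∀ η : PrimeSpectrum R, Minimal (· ∈ Module.support R P) η →
        (∀ x ∈ N, ∃ s ∉ η.asIdeal, s • x ∈ P) ∧ ∀ x ∈ P, ∃ s ∉ η.asIdeal, s • x ∈ N := by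
  refine forall₂_congr fun η _ => ?_
  rw [le_antisymm_iff, localized_le_localized_iff, localized_le_localized_iff]
  rfl

/-- A radical ideal `I` generates the maximal ideal in the localization at a minimal prime `𝔭` over
`I`; as `𝔭` is finitely generated, one denominator is enough. -/
theorem exists_mul_mem_of_isRadical {R : Type*} [CommRing R] [IsNoetherianRing R] {I 𝔭 : Ideal R}
    (hI : I.IsRadical) (h𝔭 : 𝔭 ∈ I.minimalPrimes) : ∃ u ∉ 𝔭, ∀ x ∈ 𝔭, u * x ∈ I := by
  have := h𝔭.1.1
  refine exists_mem_forall_smul_mem (S := 𝔭.primeCompl) (P := 𝔭) (Q := I)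
    (IsNoetherian.noetherian 𝔭) fun x hx => ?_
  -- a prime avoiding the powers of `x` and the complement of `𝔭` would lie strictly below `𝔭`
  by_cases hdisj : Disjoint (I : Set R) (Submonoid.powers x ⊔ 𝔭.primeCompl : Submonoid R)
  · exfalso
    obtain ⟨q, hq, hIq, hqS⟩ := Ideal.exists_le_prime_disjoint I _ hdisj
    have hq𝔭 : q ≤ 𝔭 := fun y hy => by
      by_contra hy'
      exact Set.disjoint_left.mp hqS hy (Submonoid.mem_sup_right hy')
    exact Set.disjoint_left.mp hqS (h𝔭.2 ⟨hq, hIq⟩ hq𝔭 hx)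
      (Submonoid.mem_sup_left (Submonoid.mem_powers x))
  · obtain ⟨z, hzI, hz⟩ := Set.not_disjoint_iff.mp hdisj
    obtain ⟨_, ⟨n, rfl⟩, u, hu, rfl⟩ := Submonoid.mem_sup.mp hz
    refine ⟨u, hu, hI ⟨n + 1, ?_⟩⟩
    rw [smul_eq_mul, mul_pow, show u ^ (n + 1) * x ^ (n + 1) = (u ^ n * x) * (x ^ n * u) by ring]
    exact I.mul_mem_left _ hzI

namespace CartierStructure

variable {p : ℕ} [Fact p.Prime] {R M : Type*} [CommRing R] [AddCommGroup M] [Module R M]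
  (κ : CartierStructure p R M) {f : R} {t : ℚ≥0}

omit [Fact p.Prime] in
theorem plus_bot : κ.plus f t ⊥ = ⊥ := by
  refine le_bot_iff.mp (plus_le_iff.mpr ?_)
  rintro e - n hn
  simp [(Submodule.mem_bot R).mp hn]

/-- If `C_+ P = P` and `N` is a `C`-submodule, then `x^n P ⊆ N` already gives `x P ⊆ N`. For
`N = 0` this says that the annihilator of `P` is radical. -/
theorem smul_mem_of_pow_smul_mem {P N : Submodule R M} (hP : κ.plus f t P = P)
    (hN : κ.plus f t N ≤ N) {x : R} {n : ℕ} (h : ∀ m ∈ P, x ^ n • m ∈ N) :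
    ∀ m ∈ P, x • m ∈ N := by
  have hstep : ∀ y : R, (∀ m ∈ P, y ^ p • m ∈ N) → ∀ m ∈ P, y • m ∈ N := fun y hy m hm =>
    hN (κ.smul_mem_plus hy (hP.symm ▸ hm))
  have hk : ∀ k, (∀ m ∈ P, x ^ p ^ k • m ∈ N) → ∀ m ∈ P, x • m ∈ N := by
    intro k
    induction k with
    | zero => simp
    | succ k ih =>
      intro hk
      refine ih (hstep _ ?_)
      simpa [← pow_mul, ← pow_succ] using hk
  exact hk n fun m hm =>
    pow_smul_mem_of_le (Nat.lt_pow_self (Fact.out : p.Prime).one_lt).le (h m hm)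

theorem isRadical_annihilator {P : Submodule R M} (hP : κ.plus f t P = P) :
    (Module.annihilator R P).IsRadical := by
  rintro x ⟨n, hn⟩
  rw [Module.mem_annihilator] at hn ⊢
  have := κ.smul_mem_of_pow_smul_mem hP (N := ⊥) κ.plus_bot.le (x := x) (n := n) fun m hm => by
    simpa using congrArg Subtype.val (hn ⟨m, hm⟩)
  rintro ⟨m, hm⟩
  exact Subtype.ext (by simpa using this m hm)

theorem minimal_support_iff [IsNoetherianRing R] [Module.Finite R M] {P : Submodule R M}
    {η : PrimeSpectrum R} : Minimal (· ∈ Module.support R P) η ↔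
      η.asIdeal ∈ (Module.annihilator R P).minimalPrimes := by
  rw [Module.support_eq_zeroLocus]
  constructor
  · intro h
    exact ⟨⟨η.isPrime, h.prop⟩, fun q hq hle => h.le_of_le (y := ⟨q, hq.1⟩) hq.2 hle⟩
  · intro h
    exact ⟨h.1.2, fun q hq hle => h.2 ⟨q.isPrime, hq⟩ hle⟩

/-- For `t > 0` the function `f` does not vanish at the generic points of a module `P = C_+ P`. -/
theorem notMem_of_minimal_support [IsNoetherianRing R] [Module.Finite R M] (ht : t ≠ 0)
    {P : Submodule R M} (hP : κ.plus f t P = P) {η : PrimeSpectrum R}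
    (hη : Minimal (· ∈ Module.support R P) η) : f ∉ η.asIdeal := by
  intro hf
  have hp : p ≠ 0 := (Fact.out : p.Prime).ne_zero
  have hη' := minimal_support_iff.mp hη
  obtain ⟨u, hu, h⟩ := exists_mul_mem_of_isRadical (κ.isRadical_annihilator hP) hη'
  have huf : ∀ m ∈ P, (u * f) • m = 0 := fun m hm => by
    simpa using congrArg Subtype.val (Module.mem_annihilator.mp (h f hf) ⟨m, hm⟩)
  have huP : P ≤ (⊥ : Submodule R M).comap (LinearMap.lsmul R M u) := by
    rw [← hP]
    refine plus_le_iff.mpr fun e _ n hn => ?_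
    change u • κ.iter e _ ∈ (⊥ : Submodule R M)
    have h1 : ⌈t * (p : ℚ≥0) ^ e⌉₊ ≠ 0 :=
      (Nat.ceil_pos.mpr (mul_pos (pos_iff_ne_zero.mpr ht) (by positivity))).ne'
    obtain ⟨a, ha⟩ := Nat.exists_eq_succ_of_ne_zero h1
    obtain ⟨b, hb⟩ := Nat.exists_eq_succ_of_ne_zero (pow_ne_zero e hp)
    rw [← κ.iter_pow_smul, ← mul_smul, hb, ha, pow_succ, pow_succ, mul_mul_mul_comm, mul_smul,
      huf n hn, smul_zero, map_zero]
    exact Submodule.zero_mem _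
  exact hu (hη'.1.2 (Module.mem_annihilator.mpr fun m => Subtype.ext (huP m.2)))

/-- If `P = C_+ P`, then `f^⌈t p⌉ P ⊆ κ (f^⌈t p⌉ P)`. -/
theorem exists_map_pow_smul_eq {P : Submodule R M} (hP : κ.plus f t P = P) {m : M} (hm : m ∈ P) :
    ∃ m' ∈ P, κ (f ^ ⌈t * p⌉₊ • m') = f ^ ⌈t * p⌉₊ • m := by
  have hp : 1 ≤ p := (Fact.out : p.Prime).one_le
  set a := ⌈t * p⌉₊
  let Y : Submodule R M :=
    { carrier := {m | ∃ m' ∈ P, κ (f ^ a • m') = f ^ a • m}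
      zero_mem' := ⟨0, P.zero_mem, by simp⟩
      add_mem' := by
        rintro x y ⟨x', hx', hx⟩ ⟨y', hy', hy⟩
        exact ⟨x' + y', P.add_mem hx' hy', by rw [smul_add, map_add, hx, hy, smul_add]⟩
      smul_mem' := by
        rintro r x ⟨x', hx', hx⟩
        exact ⟨r ^ p • x', P.smul_mem _ hx', by
          rw [smul_comm, κ.map_pow_smul, hx, smul_comm]⟩ }
  suffices P ≤ Y from this hm
  conv_lhs => rw [← hP]
  refine plus_le_iff.mpr fun e he n hn => ?_
  obtain ⟨d, rfl⟩ : ∃ d, e = d + 1 := ⟨e - 1, by lia⟩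
  refine ⟨(f ^ a) ^ (p - 1) • κ.iter d (f ^ ⌈t * (p : ℚ≥0) ^ (d + 1)⌉₊ • n),
    P.smul_mem _ ?_, ?_⟩
  · rcases Nat.eq_zero_or_pos d with rfl | hd
    · exact P.smul_mem _ hn
    · have h1 : ⌈t * (p : ℚ≥0) ^ d⌉₊ ≤ ⌈t * (p : ℚ≥0) ^ (d + 1)⌉₊ := by
        refine Nat.ceil_le_ceil ?_
        gcongr
        · exact_mod_cast hp
        · exact d.le_succ
      rw [← Nat.sub_add_cancel h1, pow_add, mul_comm, mul_smul]
      exact hP.le (κ.iter_smul_mem_plus hd (P.smul_mem _ hn))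
  · rw [← mul_smul, ← pow_succ', Nat.sub_add_cancel hp, κ.map_pow_smul, iter_succ_apply]

/-- Existence of test elements: at each generic point `η` of `P = C_+ P` there is a `c ∉ η` with
`c P ⊆ N` for every `C`-submodule `N` that contains `P` at `η`. At `η` the function `f` is
invertible unless `t = 0`, so `C` can be replaced by its element `κ f^⌈t p⌉`. -/
theorem exists_testElement [CharP R p] [IsNoetherianRing R] [Module.Finite R M]
    (hR : (frobenius R p).Finite) {P : Submodule R M} (hP : κ.plus f t P = P)
    {η : PrimeSpectrum R} (hη : Minimal (· ∈ Module.support R P) η) :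
    ∃ c ∉ η.asIdeal, ∀ N : Submodule R M, κ.plus f t N ≤ N →
      (∀ m ∈ P, ∃ s ∉ η.asIdeal, s • m ∈ N) → ∀ m ∈ P, c • m ∈ N := by
  have := η.isPrime
  obtain ⟨u, hu, huη⟩ := exists_mul_mem_of_isRadical (κ.isRadical_annihilator hP)
    (minimal_support_iff.mp hη)
  have hfη : f ^ ⌈t * p⌉₊ ∉ η.asIdeal := by
    by_cases ht : t = 0
    · simpa [ht] using η.isPrime.one_notMem
    · exact fun h => κ.notMem_of_minimal_support ht hP hη (η.isPrime.mem_of_pow_mem _ h)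
  have hκ : ∀ N : Submodule R M, κ.plus f t N ≤ N → ∀ m ∈ N, κ (f ^ ⌈t * p⌉₊ • m) ∈ N :=
    fun N hN m hm => by simpa [iter] using hN (κ.iter_smul_mem_plus le_rfl hm)
  let κ' : CartierStructure p R P :=
    { toFun := fun m => ⟨κ (f ^ ⌈t * p⌉₊ • m), hκ P hP.le m m.2⟩
      map_zero' := by ext; simp
      map_add' := fun x y => by ext; simp
      map_pow_smul' := fun r m => by
        ext
        change κ (f ^ ⌈t * p⌉₊ • r ^ p • (m : M)) = r • κ (f ^ ⌈t * p⌉₊ • (m : M))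
        rw [smul_comm, κ.map_pow_smul] }
  obtain ⟨c, hc, h⟩ := exists_pow_smul_mem_of_surjective hR η.asIdeal hu
    (fun x hx m => by rw [← mul_smul]; exact Module.mem_annihilator.mp (huη x hx) m) κ' hfη
    (fun m => by
      obtain ⟨m', hm', h⟩ := κ.exists_map_pow_smul_eq hP m.2
      exact ⟨⟨m', hm'⟩, Subtype.ext h⟩)
  refine ⟨c, hc, fun N hN hNP => ?_⟩
  obtain ⟨x, hx, hxN⟩ := exists_mem_forall_smul_mem (S := η.asIdeal.primeCompl)
    (IsNoetherian.noetherian P) hNP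
  obtain ⟨k, hk⟩ := h (N.comap P.subtype) (fun n hn => hκ N hN n hn)
    ⟨x, hx, fun m => hxN m m.2⟩
  exact κ.smul_mem_of_pow_smul_mem hP hN fun m hm => hk ⟨m, hm⟩

/-- Test modules exist: the intersection of all competing `C`-submodules contains `c P` for a
test element `c` at each generic point of `P = underline M`, so it still agrees with `P` there. -/
theorem hasTestModule [CharP R p] [IsNoetherianRing R] [Module.Finite R M]
    (hR : (frobenius R p).Finite) (f : R) (t : ℚ≥0) : κ.HasTestModule f t := by
  have hp := (Fact.out : p.Prime).two_le
  refine ⟨κ.eventually_plusPow_eq_underline f t hp, ⟨?_, ?_⟩, fun N hN => sInf_le hN⟩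
  · exact le_sInf fun N hN => (κ.plus_mono (sInf_le hN)).trans hN.1
  · refine genericallyAgree_iff.mpr fun η hη => ⟨fun x hx => ?_, ?_⟩
    · have hmem : κ.underline f t ∈ κ.testSubmodules f t :=
        ⟨(κ.plus_underline f t hp).le, fun _ _ => rfl⟩
      exact ⟨1, η.isPrime.one_notMem, by simpa using sInf_le hmem hx⟩
    · obtain ⟨c, hc, h⟩ := κ.exists_testElement hR (κ.plus_underline f t hp) hη
      exact fun x hx => ⟨c, hc, Submodule.mem_sInf.mpr fun N hN =>
        h N hN.1 (genericallyAgree_iff.mp hN.2 η hη).2 x hx⟩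

end CartierStructure

/-! ### Dependence on the exponent, and nil-isomorphisms -/

namespace CartierStructure

variable {p : ℕ} {R M : Type*} [CommRing R] [AddCommGroup M] [Module R M]
  (κ : CartierStructure p R M) {f : R} {t t' : ℚ≥0}

theorem iter_add_apply (a b : ℕ) (m : M) : κ.iter (a + b) m = κ.iter a (κ.iter b m) :=
  Function.iterate_add_apply κ a b m

theorem plus_le_plus_of_le (htt' : t ≤ t') (N : Submodule R M) :
    κ.plus f t' N ≤ κ.plus f t N := by
  refine plus_le_iff.mpr fun e he n hn => ?_
  have h1 : ⌈t * (p : ℚ≥0) ^ e⌉₊ ≤ ⌈t' * (p : ℚ≥0) ^ e⌉₊ := Nat.ceil_le_ceil (by gcongr)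
  rw [← Nat.sub_add_cancel h1, pow_add, mul_comm, mul_smul]
  exact κ.iter_smul_mem_plus he (N.smul_mem _ hn)

theorem underline_le_underline_of_le (htt' : t ≤ t') : κ.underline f t' ≤ κ.underline f t := by
  refine iInf_mono fun h => ?_
  induction h with
  | zero => exact le_rfl
  | succ h ih =>
    rw [plusPow_succ, plusPow_succ]
    exact (κ.plus_mono ih).trans (κ.plus_le_plus_of_le htt' _)

theorem pow_smul_mem_plus_of_mem_plus {N : Submodule R M} {m : M} (hm : m ∈ κ.plus f t N) :
    f ^ ⌈t'⌉₊ • m ∈ κ.plus f t' N := by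
  suffices κ.plus f t N ≤ (κ.plus f t' N).comap (LinearMap.lsmul R M (f ^ ⌈t'⌉₊)) from this hm
  refine plus_le_iff.mpr fun e he n hn => ?_
  change f ^ ⌈t'⌉₊ • κ.iter e (f ^ ⌈t * (p : ℚ≥0) ^ e⌉₊ • n) ∈ κ.plus f t' N
  have h1 : ⌈t' * (p : ℚ≥0) ^ e⌉₊ ≤ ⌈t'⌉₊ * p ^ e := by
    rw [Nat.ceil_le]
    push_cast
    gcongr
    exact Nat.le_ceil t'
  rw [← κ.iter_pow_smul, ← pow_mul, ← Nat.sub_add_cancel h1, pow_add, mul_comm, mul_smul]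
  exact κ.iter_smul_mem_plus he (N.smul_mem _ (N.smul_mem _ hn))

/-- Where `f` is invertible, the stable values for all exponents agree. -/
theorem exists_pow_smul_mem_underline [Fact p.Prime] [IsNoetherianRing R] [Module.Finite R M]
    (f : R) (t t' : ℚ≥0) : ∃ j, ∀ m ∈ κ.underline f t, f ^ j • m ∈ κ.underline f t' := by
  have hp := (Fact.out : p.Prime).two_le
  have key : ∀ h, ∃ j, ∀ m ∈ κ.plusPow f t h, f ^ j • m ∈ κ.plusPow f t' h := by
    intro h
    induction h with
    | zero => exact ⟨0, fun m _ => trivial⟩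
    | succ h ih =>
      obtain ⟨j, hj⟩ := ih
      refine ⟨j + ⌈t'⌉₊, fun m hm => ?_⟩
      rw [plusPow_succ] at hm ⊢
      rw [pow_add, mul_smul, smul_comm]
      refine κ.pow_smul_mem_plus_of_mem_plus (κ.smul_mem_plus (fun n hn => ?_) hm)
      rw [← pow_mul]
      exact pow_smul_mem_of_le (Nat.le_mul_of_pos_right j (by lia)) (hj n hn)
  obtain ⟨h, h₁, h₂⟩ := ((κ.eventually_plusPow_eq_underline f t hp).and
    (κ.eventually_plusPow_eq_underline f t' hp)).exists
  rw [← h₁, ← h₂]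
  exact key h

/-- A generic point of the smaller stable value lies outside `f = 0` unless both exponents vanish,
so it is a generic point of the larger one as well, where the two coincide. -/
theorem testModule_antitone [Fact p.Prime] [CharP R p] [IsNoetherianRing R] [Module.Finite R M]
    (hR : (frobenius R p).Finite) (f : R) : Antitone (κ.testModule f) := by
  intro t t' htt'
  rcases eq_or_ne t' 0 with rfl | ht'
  · rw [nonpos_iff_eq_zero.mp htt']
  have hp := (Fact.out : p.Prime).two_le
  have hτ := (κ.hasTestModule hR f t).2.1
  refine sInf_le ⟨(κ.plus_le_plus_of_le htt' _).trans hτ.1,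
    genericallyAgree_iff.mpr fun η hη => ?_⟩
  have hf : f ∉ η.asIdeal := κ.notMem_of_minimal_support ht' (κ.plus_underline f t' hp) hη
  obtain ⟨j, hj⟩ := κ.exists_pow_smul_mem_underline f t t'
  have hle := κ.underline_le_underline_of_le (f := f) htt'
  have hη' : Minimal (· ∈ Module.support R (κ.underline f t)) η := by
    refine ⟨Module.support_subset_of_injective (Submodule.inclusion hle)
      (Submodule.inclusion_injective hle) hη.prop, fun q hq hle => hη.le_of_le ?_ hle⟩
    rw [Module.support_eq_zeroLocus] at hq ⊢
    intro x hx
    have h1 : f ^ j * x ∈ q.asIdeal := hq <| Module.mem_annihilator.mpr fun m => Subtype.ext <| by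
      have := congrArg Subtype.val (Module.mem_annihilator.mp hx ⟨_, hj m m.2⟩)
      simpa [mul_smul, smul_comm x] using this
    exact (q.isPrime.mem_or_mem h1).resolve_left fun h =>
      hf (hle (q.isPrime.mem_of_pow_mem _ h))
  obtain ⟨h₁, h₂⟩ := genericallyAgree_iff.mp hτ.2 η hη'
  refine ⟨fun x hx => ?_, fun x hx => h₂ x (hle hx)⟩
  obtain ⟨s, hs, hsx⟩ := h₁ x hx
  exact ⟨f ^ j * s, η.asIdeal.primeCompl.mul_mem (η.asIdeal.primeCompl.pow_mem hf j) hs, by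
    rw [mul_smul]; exact hj _ hsx⟩

/-- `s (C_+)^h P` is contained in `Q` if all `κ^e (R s P)` with `e ≥ h` are, because `(C_+)^h` only
involves `κ^e` with `e ≥ h`. -/
theorem smul_mem_of_forall_iter_mem [Fact p.Prime] {P Q : Submodule R M} {s : R} {h : ℕ}
    (hQ : ∀ e, h ≤ e → ∀ m ∈ P, ∀ a : R, κ.iter e (a • s • m) ∈ Q) {m : M}
    (hm : m ∈ (κ.plus f t)^[h] P) : s • m ∈ Q := by
  let L : ℕ → Submodule R M := fun i =>
    { carrier := {m | ∀ e, i ≤ e → ∀ a : R, κ.iter e (a • s • m) ∈ Q}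
      zero_mem' := by simp
      add_mem' := fun hx hy e he a => by
        rw [smul_add, smul_add, map_add]
        exact Q.add_mem (hx e he a) (hy e he a)
      smul_mem' := fun r x hx e he a => by
        rw [smul_comm s, smul_smul]
        exact hx e he (a * r) }
  have hL : ∀ i, κ.plus f t (L (i + 1)) ≤ L i := fun i => by
    refine plus_le_iff.mpr fun d hd n hn e he a => ?_
    obtain ⟨b, hb⟩ := Nat.exists_eq_succ_of_ne_zero
      (pow_ne_zero d (Fact.out : p.Prime).ne_zero)
    have h1 := hn (e + d) (by lia) (a ^ p ^ d * f ^ ⌈t * (p : ℚ≥0) ^ d⌉₊ * s ^ b)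
    rwa [mul_smul, mul_smul, ← mul_smul (s ^ b), ← pow_succ, ← Nat.succ_eq_add_one, ← hb,
      smul_comm (f ^ _), κ.iter_add_apply, κ.iter_pow_smul, κ.iter_pow_smul] at h1
  have key : ∀ i k, i + k = h → (κ.plus f t)^[k] P ≤ L i := by
    intro i k
    induction k generalizing i with
    | zero => rintro rfl m hm e he a; exact hQ e he m hm a
    | succ k ih =>
      intro hik
      rw [Function.iterate_succ_apply']
      exact (κ.plus_mono (ih (i + 1) (by lia))).trans (hL i)
  simpa [iter] using key 0 h (zero_add h) hm 0 le_rfl 1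

end CartierStructure

namespace CartierHom

variable {p : ℕ} {R M N : Type*} [CommRing R] [AddCommGroup M] [Module R M] [AddCommGroup N]
  [Module R N] {κM : CartierStructure p R M} {κN : CartierStructure p R N}
  (φ : CartierHom κM κN)

theorem isNilIso_iff : φ.IsNilIso ↔
    (∃ j, ∀ m, φ.toLinearMap m = 0 → κM.iter j m = 0) ∧
      ∃ j, ∀ n, κN.iter j n ∈ LinearMap.range φ.toLinearMap := by
  have h1 : ∀ j (m : LinearMap.ker φ.toLinearMap), (φ.ker.iter j m : M) = κM.iter j m := by
    intro j m
    induction j with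
    | zero => rfl
    | succ j ih =>
      rw [CartierStructure.iter_succ_apply, CartierStructure.iter_succ_apply, ← ih]
      rfl
  have h2 : ∀ j n, φ.coker.iter j (Submodule.Quotient.mk n) =
      Submodule.Quotient.mk (κN.iter j n) := by
    intro j n
    induction j with
    | zero => rfl
    | succ j ih =>
      rw [CartierStructure.iter_succ_apply, CartierStructure.iter_succ_apply, ih]
      rfl
  refine and_congr (exists_congr fun j => ?_) (exists_congr fun j => ?_)
  · simp only [Subtype.forall, LinearMap.mem_ker, Subtype.ext_iff, h1, ZeroMemClass.coe_zero]
  · rw [(Submodule.Quotient.mk_surjective _).forall]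
    simp only [h2, Submodule.Quotient.mk_eq_zero]

variable {f : R} {t : ℚ≥0}

theorem map_plus (L : Submodule R M) :
    (κM.plus f t L).map φ.toLinearMap = κN.plus f t (L.map φ.toLinearMap) := by
  refine le_antisymm (Submodule.map_le_iff_le_comap.mpr <|
    CartierStructure.plus_le_iff.mpr fun e he m hm => ?_) (CartierStructure.plus_le_iff.mpr ?_)
  · rw [Submodule.mem_comap, map_iter, map_smul]
    exact κN.iter_smul_mem_plus he ⟨m, hm, rfl⟩
  · rintro e he _ ⟨m, hm, rfl⟩
    exact ⟨_, κM.iter_smul_mem_plus he hm, by rw [map_iter, map_smul]⟩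

/-- The kernel of `φ` meets `P` in a nilpotent submodule, which is invisible to `P = (C_+)^j P`. -/
theorem annihilator_map_eq [Fact p.Prime] (hφ : φ.IsNilIso) {P : Submodule R M}
    (hP : κM.plus f t P = P) :
    Module.annihilator R (P.map φ.toLinearMap) = Module.annihilator R P := by
  obtain ⟨j, hj⟩ := (φ.isNilIso_iff.mp hφ).1
  have hfix : (κM.plus f t)^[j] P = P := Function.iterate_fixed hP j
  ext s
  simp only [← Submodule.annihilator.eq_1, Submodule.mem_annihilator]
  constructor
  · intro hs m hm
    refine (Submodule.mem_bot R).mp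
      (κM.smul_mem_of_forall_iter_mem (f := f) (t := t) (P := P) (h := j) ?_ (hfix.symm ▸ hm))
    intro e he m hm a
    have h0 : φ.toLinearMap (a • s • m) = 0 := by
      rw [map_smul, map_smul, hs _ ⟨m, hm, rfl⟩, smul_zero]
    rw [Submodule.mem_bot, ← Nat.add_sub_cancel' he, CartierStructure.iter_add_apply]
    exact hj _ (by rw [map_iter, h0, map_zero])
  · rintro hs _ ⟨m, hm, rfl⟩
    rw [← map_smul, hs m hm, map_zero]

variable [Fact p.Prime] [IsNoetherianRing R] [Module.Finite R M] [Module.Finite R N]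

/-- The stable values correspond: `(C_+)^l N` is contained in the image of `φ` for large `l`. -/
theorem map_underline (hφ : φ.IsNilIso) :
    (κM.underline f t).map φ.toLinearMap = κN.underline f t := by
  have hp := (Fact.out : p.Prime).two_le
  obtain ⟨l, hl⟩ := (φ.isNilIso_iff.mp hφ).2
  have h1 : ∀ h, (κM.plusPow f t h).map φ.toLinearMap ≤ κN.plusPow f t h := by
    intro h
    induction h with
    | zero => exact le_top
    | succ h ih =>
      rw [CartierStructure.plusPow_succ, CartierStructure.plusPow_succ, map_plus]
      exact κN.plus_mono ih
  have h2 : ∀ h, κN.plusPow f t (h + l) ≤ (κM.plusPow f t h).map φ.toLinearMap := by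
    intro h
    induction h with
    | zero =>
      intro n hn
      rw [zero_add] at hn
      rw [CartierStructure.plusPow_zero, Submodule.map_top]
      have := κN.smul_mem_of_forall_iter_mem (s := 1) (Q := LinearMap.range φ.toLinearMap)
        (fun e he m _ a => by
          rw [← Nat.add_sub_cancel' he, CartierStructure.iter_add_apply]
          exact hl _) hn
      rwa [one_smul] at this
    | succ h ih =>
      rw [add_right_comm, CartierStructure.plusPow_succ, CartierStructure.plusPow_succ, map_plus]
      exact κN.plus_mono ih
  obtain ⟨h, hh⟩ := ((κM.eventually_plusPow_eq_underline f t hp).and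
    (κN.eventually_plusPow_eq_underline f t hp)).exists_forall_of_atTop
  rw [← (hh h le_rfl).1]
  refine le_antisymm ((h1 h).trans (hh h le_rfl).2.le) ?_
  rw [← (hh (h + l) (by lia)).2]
  exact h2 h

/-- The stable values of `M` and `N` have the same generic points, and competitors for the two test
modules are obtained from each other by image and preimage. -/
theorem map_testModule [CharP R p] (hR : (frobenius R p).Finite) (hφ : φ.IsNilIso) (f : R)
    (t : ℚ≥0) : (κM.testModule f t).map φ.toLinearMap = κN.testModule f t := by
  have hp := (Fact.out : p.Prime).two_le
  have hM := (κM.hasTestModule hR f t).2.1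
  have hN := (κN.hasTestModule hR f t).2.1
  have hP := κM.plus_underline f t hp
  have hmap := φ.map_underline hφ (f := f) (t := t)
  have hmin : ∀ η, Minimal (· ∈ Module.support R (κN.underline f t)) η ↔
      Minimal (· ∈ Module.support R (κM.underline f t)) η := fun η => by
    rw [CartierStructure.minimal_support_iff, CartierStructure.minimal_support_iff, ← hmap,
      φ.annihilator_map_eq hφ hP]
  refine le_antisymm (Submodule.map_le_iff_le_comap.mpr ?_) (sInf_le ⟨?_, ?_⟩)
  · refine (sInf_le ⟨?_, ?_⟩ : κM.testModule f t ≤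
      (κN.testModule f t).comap φ.toLinearMap ⊓ κM.underline f t).trans inf_le_left
    · refine le_inf (Submodule.map_le_iff_le_comap.mp ?_) ((κM.plus_mono inf_le_right).trans hP.le)
      rw [map_plus]
      refine (κN.plus_mono ?_).trans hN.1
      exact Submodule.map_le_iff_le_comap.mpr inf_le_left
    · refine genericallyAgree_iff.mpr fun η hη => ⟨fun x hx =>
        ⟨1, η.isPrime.one_notMem, by simpa using hx.2⟩, fun x hx => ?_⟩
      obtain ⟨s, hs, h⟩ := (genericallyAgree_iff.mp hN.2 η ((hmin η).mpr hη)).2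
        (φ.toLinearMap x) (hmap ▸ ⟨x, hx, rfl⟩)
      refine ⟨s, hs, ?_, Submodule.smul_mem _ _ hx⟩
      rwa [← map_smul] at h
  · rw [← map_plus]
    exact Submodule.map_mono hM.1
  · refine genericallyAgree_iff.mpr fun η hη => ?_
    obtain ⟨h₁, h₂⟩ := genericallyAgree_iff.mp hM.2 η ((hmin η).mp hη)
    rw [← hmap]
    constructor
    · rintro _ ⟨x, hx, rfl⟩
      obtain ⟨s, hs, h⟩ := h₁ x hx
      exact ⟨s, hs, s • x, h, map_smul _ _ _⟩
    · rintro _ ⟨x, hx, rfl⟩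
      obtain ⟨s, hs, h⟩ := h₂ x hx
      exact ⟨s, hs, s • x, h, map_smul _ _ _⟩

end CartierHom

/-! ### The modules `F^{e!} M` and their colimit -/

/-- Evaluation at generators of `F^e_* R` embeds `F^{e!} M` into a power of `M`, and submodules map
to submodules, so `F^{e!} M` is Noetherian. -/
theorem FShriek.finite {p : ℕ} [Fact p.Prime] {R M : Type*} [CommRing R] [CharP R p]
    [IsNoetherianRing R] [AddCommGroup M] [Module R M] [Module.Finite R M]
    (hR : (frobenius R p).Finite) (e : ℕ) : Module.Finite R (FShriek p e R M) := by
  obtain ⟨n, g, hg⟩ := (iterateFrobenius_finite hR e).exists_generators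
  let ev : FShriek p e R M → Fin n → M := fun ψ i => ψ (g i)
  have hev : Function.Injective ev := fun ψ ψ' h => by
    ext s
    obtain ⟨a, rfl⟩ := hg s
    simp only [map_sum, iterateFrobenius_def, FShriek.map_pow_mul]
    exact Finset.sum_congr rfl fun i _ => congrArg (a i • ·) (congrFun h i)
  let im : Submodule R (FShriek p e R M) → Submodule R (Fin n → M) := fun L =>
    { carrier := ev '' L
      zero_mem' := ⟨0, L.zero_mem, rfl⟩
      add_mem' := by
        rintro _ _ ⟨x, hx, rfl⟩ ⟨y, hy, rfl⟩
        exact ⟨x + y, L.add_mem hx hy, rfl⟩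
      smul_mem' := by
        rintro r _ ⟨x, hx, rfl⟩
        exact ⟨r ^ p ^ e • x, L.smul_mem _ hx, funext fun i => x.map_pow_mul r (g i)⟩ }
  have him : StrictMono im := fun L L' h => by
    have : ev '' (L : Set (FShriek p e R M)) ⊂ ev '' L' :=
      hev.image_strictMono h
    exact this
  have : WellFoundedGT (Submodule R (FShriek p e R M)) := him.wellFoundedGT
  have : IsNoetherian R (FShriek p e R M) := isNoetherian_iff'.mpr this
  infer_instance

namespace CartierStructure

variable {p : ℕ} {R M : Type*} [CommRing R] [AddCommGroup M] [Module R M]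
  (κ : CartierStructure p R M)

/-- The morphism `M → F^{e!} M`, `m ↦ [s ↦ κ^e (s m)]`. -/
def toShriek [Fact p.Prime] [CharP R p] (e : ℕ) : CartierHom κ (κ.shriek e) where
  toLinearMap := κ.transition 0 e e.zero_le ∘ₗ FShriek.zeroEmb
  map_cartier' m := by
    ext s
    change κ.iter e (s • κ m) = κ (κ.iter e (s ^ p • m))
    rw [← κ.map_pow_smul, ← iter_succ_apply, iter_succ_apply']

theorem toShriek_apply [Fact p.Prime] [CharP R p] (e : ℕ) (m : M) (s : R) :
    (κ.toShriek e).toLinearMap m s = κ.iter e (s • m) := rfl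

theorem toUnit_toShriek [Fact p.Prime] [CharP R p] (e : ℕ) (m : M) :
    κ.toUnit e ((κ.toShriek e).toLinearMap m) = κ.ofBase m :=
  κ.toUnit_transition 0 e e.zero_le _

theorem shriek_iter_apply [Fact p.Prime] [CharP R p] (e j : ℕ) (ψ : FShriek p e R M) (s : R) :
    (κ.shriek e).iter j ψ s = κ.iter j (ψ (s ^ p ^ j)) := by
  induction j generalizing s with
  | zero => simp [iter]
  | succ j ih =>
    rw [iter_succ_apply, shriek_apply, ih, iter_succ_apply, ← pow_mul, ← pow_succ']

/-- The kernel is killed by `κ^e`, and `κ^e` maps `ψ` to the image of `ψ 1`. -/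
theorem toShriek_isNilIso [Fact p.Prime] [CharP R p] (e : ℕ) : (κ.toShriek e).IsNilIso := by
  refine (κ.toShriek e).isNilIso_iff.mpr ⟨⟨e, fun m hm => ?_⟩, ⟨e, fun ψ => ⟨ψ 1, ?_⟩⟩⟩
  · have := DFunLike.congr_fun hm (1 : R)
    rwa [toShriek_apply, one_smul] at this
  · ext s
    rw [toShriek_apply, shriek_iter_apply, ← ψ.map_pow_mul, mul_one]

theorem directedSystem_transition :
    DirectedSystem (fun e : ℕ => FShriek p e R M) fun i j h => κ.transition i j h where
  map_self i ψ := by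
    ext s
    simp [iter]
  map_map i j k hij hjk ψ := by
    ext s
    simp only [transition_apply]
    rw [← iter_add_apply, Nat.sub_add_sub_cancel hjk hij]

theorem exists_toUnit_eq (x : κ.UnitModule) : ∃ e ψ, κ.toUnit e ψ = x :=
  Module.DirectLimit.exists_of x

theorem toUnit_eq_zero_iff {e : ℕ} {ψ : FShriek p e R M} :
    κ.toUnit e ψ = 0 ↔ ∃ j, ∀ s, κ.iter j (ψ s) = 0 := by
  have := κ.directedSystem_transition
  constructor
  · intro h
    obtain ⟨j, hj, h⟩ := Module.DirectLimit.of.zero_exact h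
    exact ⟨j - e, fun s => DFunLike.congr_fun h s⟩
  · rintro ⟨j, h⟩
    rw [← κ.toUnit_transition e (e + j) (by lia)]
    have h0 : κ.transition e (e + j) (by lia) ψ = 0 := by
      ext s
      simpa using h s
    rw [h0, map_zero]

end CartierStructure

namespace CartierHom

variable {p : ℕ} [Fact p.Prime] {R M N : Type*} [CommRing R] [CharP R p] [AddCommGroup M]
  [Module R M] [AddCommGroup N] [Module R N] {κM : CartierStructure p R M}
  {κN : CartierStructure p R N} (φ : CartierHom κM κN)

theorem unit_toUnit (e : ℕ) (ψ : FShriek p e R M) :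
    φ.unit.toLinearMap (κM.toUnit e ψ) = κN.toUnit e (FShriek.map φ.toLinearMap ψ) :=
  Module.DirectLimit.map_apply_of (R := R) (ι := ℕ) (G := fun e : ℕ => FShriek p e R M)
    (G' := fun e : ℕ => FShriek p e R N) (f := κM.transition) (f' := κN.transition)
    (fun _ => FShriek.map φ.toLinearMap)
    (fun i j _ => LinearMap.ext fun ψ => FShriek.ext fun s => φ.map_iter (j - i) (ψ s)) ψ

theorem unit_ofBase (m : M) :
    φ.unit.toLinearMap (κM.ofBase m) = κN.ofBase (φ.toLinearMap m) := by
  change φ.unit.toLinearMap (κM.toUnit 0 _) = κN.toUnit 0 _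
  rw [unit_toUnit]
  congr 1
  ext s
  exact map_smul φ.toLinearMap s m

theorem unit_injective (hφ : φ.IsNilIso) : Function.Injective φ.unit.toLinearMap := by
  obtain ⟨l, hl⟩ := (φ.isNilIso_iff.mp hφ).1
  refine (injective_iff_map_eq_zero _).mpr fun x hx => ?_
  obtain ⟨e, ψ, rfl⟩ := κM.exists_toUnit_eq x
  rw [unit_toUnit, κN.toUnit_eq_zero_iff] at hx
  obtain ⟨j, hj⟩ := hx
  refine κM.toUnit_eq_zero_iff.mpr ⟨l + j, fun s => ?_⟩
  rw [CartierStructure.iter_add_apply]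
  refine hl _ ?_
  rw [map_iter]
  exact hj s

omit [Fact p.Prime] [CharP R p] in
/-- A power of `κ` maps `χ` into the image of `φ`. A set-theoretic lift to `M` is unique up to the
kernel of `φ`, so it becomes linear after applying `κ^l`, which kills that kernel. -/
theorem exists_map_eq_transition {l j : ℕ} (hl : ∀ m, φ.toLinearMap m = 0 → κM.iter l m = 0)
    (hj : ∀ n, κN.iter j n ∈ LinearMap.range φ.toLinearMap) {e : ℕ} (χ : FShriek p e R N) :
    ∃ ψ : FShriek p (e + (l + j)) R M,
      FShriek.map φ.toLinearMap ψ = κN.transition e (e + (l + j)) (by lia) χ := by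
  choose g hg using hj
  have hl' : ∀ m m', φ.toLinearMap m = φ.toLinearMap m' → κM.iter l m = κM.iter l m' :=
    fun m m' h => by
      rw [← sub_eq_zero, ← map_sub]
      exact hl _ (by rw [map_sub, h, sub_self])
  refine ⟨⟨⟨⟨fun s => κM.iter l (g (χ s)), ?_⟩, fun a b => ?_⟩, fun r s => ?_⟩, ?_⟩
  · refine hl _ ?_
    rw [hg, map_zero, map_zero]
  · change κM.iter l (g (χ (a + b))) = κM.iter l (g (χ a)) + κM.iter l (g (χ b))
    rw [← map_add]
    refine hl' _ _ ?_
    rw [hg, map_add, map_add, map_add, hg, hg]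
  · change κM.iter l (g (χ (r ^ p ^ (e + (l + j)) * s))) = r • κM.iter l (g (χ s))
    rw [← κM.iter_pow_smul]
    refine hl' _ _ ?_
    rw [hg, map_smul, hg, ← κN.iter_pow_smul, ← χ.map_pow_mul, ← pow_mul, ← pow_mul, ← pow_add,
      ← pow_add, show l + (j + e) = e + (l + j) by lia]
  · ext s
    change φ.toLinearMap (κM.iter l (g (χ s))) = κN.iter (e + (l + j) - e) (χ s)
    rw [map_iter, hg, Nat.add_sub_cancel_left, CartierStructure.iter_add_apply]

theorem unit_surjective (hφ : φ.IsNilIso) : Function.Surjective φ.unit.toLinearMap := by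
  obtain ⟨⟨l, hl⟩, j, hj⟩ := φ.isNilIso_iff.mp hφ
  intro y
  obtain ⟨e, χ, rfl⟩ := κN.exists_toUnit_eq y
  obtain ⟨ψ, hψ⟩ := φ.exists_map_eq_transition hl hj χ
  exact ⟨κM.toUnit _ ψ, by rw [unit_toUnit, hψ, κN.toUnit_transition]⟩

end CartierHom

end CartierModule

end

theorem theorem1p8 {p : ℕ} [Fact p.Prime] {k R M N : Type*}
    [Field k] [CharP k p] (hk : (frobenius k p).Finite)
    [CommRing R] [CharP R p] [Algebra k R] [Algebra.EssFiniteType k R]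
    [AddCommGroup M] [Module R M] [Module.Finite R M]
    [AddCommGroup N] [Module R N] [Module.Finite R N]
    (κM : CartierModule.CartierStructure p R M) (κN : CartierModule.CartierStructure p R N)
    (φ : CartierModule.CartierHom κM κN) (hφ : φ.IsNilIso) (f : R) :
    -- the test modules exist, and `φ (τ(M, f^t)) = τ(N, f^t)`
    (∀ t : ℚ≥0, κM.HasTestModule f t ∧ κN.HasTestModule f t ∧
      (κM.testModule f t).map φ.toLinearMap = κN.testModule f t) ∧
    -- the images of `τ(M, f^t)` form a decreasing filtration of `colim F^{e!} M`
    Antitone (fun t : ℚ≥0 => κM.unitTestModule f t) ∧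
    -- which can be computed from the test modules of any `F^{e!} M`
    (∀ (e : ℕ) (t : ℚ≥0), (κM.shriek e).HasTestModule f t ∧
      ((κM.shriek e).testModule f t).map (κM.toUnit e) = κM.unitTestModule f t) ∧
    -- the induced map of colimits is an isomorphism that identifies the two filtrations
    Function.Bijective φ.unit.toLinearMap ∧
    (∀ t : ℚ≥0, (κM.unitTestModule f t).map φ.unit.toLinearMap = κN.unitTestModule f t) := by
  have hR : (frobenius R p).Finite := CartierModule.frobenius_finite_of_essFiniteType hk
  have : IsNoetherianRing R := Algebra.EssFiniteType.isNoetherianRing k R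
  refine ⟨fun t => ⟨κM.hasTestModule hR f t, κN.hasTestModule hR f t,
    φ.map_testModule hR hφ f t⟩, fun t t' h => Submodule.map_mono (κM.testModule_antitone hR f h),
    fun e t => ?_, ⟨φ.unit_injective hφ, φ.unit_surjective hφ⟩, fun t => ?_⟩
  · have := CartierModule.FShriek.finite (M := M) hR e
    refine ⟨(κM.shriek e).hasTestModule hR f t, ?_⟩
    rw [← (κM.toShriek e).map_testModule hR (κM.toShriek_isNilIso e) f t, ← Submodule.map_comp]
    congr 1
    exact LinearMap.ext (κM.toUnit_toShriek e)
  · rw [CartierModule.CartierStructure.unitTestModule,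
      CartierModule.CartierStructure.unitTestModule, ← φ.map_testModule hR hφ f t,
      ← Submodule.map_comp, ← Submodule.map_comp]
    congr 1
    exact LinearMap.ext φ.unit_ofBase
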